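/- **Setting.** Let $m\ge 3$ and let $V=\mathbb C^2$ be the complexified plane with basis $z=x_1+ix_2$, $\bar z=x_1-ix_2$, where $x_1,x_2$ is an orthonormal basis (so $(z,z)=(\bar z,\bar z)=0$, $(z,\bar z)=2$). Put $\zeta=e^{2\pi i/m}$, and let $W=I_2(m)$ be the dihedral group of order $2m$ acting on $V$, with reflections $s_j$ ($j\in\mathbb Z/m$), $s_j(z)=\zeta^{j}\bar z$, $s_j(\bar z)=\zeta^{-j}z$, and roots $\alpha_j=z-\zeta^j\bar z$; it is generated by $s_1,s_2$. Put $e_2=z\bar z$ and $e_m=z^m+\bar z^m$. Let $c$ be a $W$-invariant function on the set of reflections with values in a field $\mathbb C(c)$ of rational functions of formal parameters. The Dunkl operators on $S_c(V)=\mathbb C(c)\otimes S(V)$ are $$\nabla_y f=\partial_y f-\sum_{j\in\mathbb Z/m} c(s_j)\langle y,\alpha_j\rangle\frac{f-s_jf}{\alpha_j}\qquad (y\in V^*).$$ They commute, so $\nabla_p$ is defined for $p\in S(V^*)\cong S(V)$ (identified by the scalar product), and one has the bilinear form $(f,g)_c=[\nabla_f g]_0$ (constant term). For $a=(a_1,a_2)\in\mathbb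 Z_{\ge0}^2$ write $a'\prec a$ if the last non-zero coordinate of $a-a'$ is positive. A *canonical invariant* $b_a$ is a homogeneous $W$-invariant element of $S_c(V)$ such that for every homogeneous generating set $u_1,u_2$ of $S(V)^W$ (of degrees $2<m$) one has $b_a\in\mathbb C^\times u_1^{a_1}u_2^{a_2}+\sum_{a'\prec a}\mathbb C(c)\,u_1^{a_1'}u_2^{a_2'}$, and $(u_1^{a_1'}u_2^{a_2'},b_a)_c=0$ for all $a'\prec a$. **Theorem.** (a) Let $c(s)=c$ for all reflections $s$, with $c$ a formal parameter. Then the canonical invariants $b_{(0,k)}$, $k\ge0$, exist, are unique up to factors in $\mathbb C^\times$, and for a suitable choice of these factors $$\sum_{k\ge0}\binom ck b_{(0,k)}t^k=\bigl(1+e_mt+e_2^mt^2\bigr)^c$$ as formal power series in $t$ over $\mathbb C(c)\otimes S(V)$. (b) Let $m$ be even and let $c_1=c(s_1)$, $c_2=c(s_2)$ be two independent formal parameters (so $c(s_j)=c_1$ for odd $j$ and $c(s_j)=c_2$ for even $j$). Put $C=c_1+c_2$, $\delta=c_2-c_1$, $e_m'=\frac14e_m-\frac12e_2^{m/2}$.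 Then the canonical invariants $b_{(0,k)}$, $k\ge0$, exist, are unique up to factors in $\mathbb C^\times$, and for a suitable choice of these factors the following holds. 1. The coefficients of all $b_{(0,k)}$, as rational functions of $(c_1,c_2)\in\mathbb C^2$, are regular wherever $C\notin\{0,1,2,\dots\}$, and for all $(c_1,c_2)\in\mathbb C^2$ with $C\notin\{0,1,2,\dots\}$ and $\frac{C-\delta-1}2\notin\mathbb Z$ one has the identity of formal power series in $t$ $$\sum_{k\ge0}\frac{\Gamma\bigl(\frac{C-\delta+1}2\bigr)\Gamma(2k-C)}{\Gamma\bigl(k-\frac{C+\delta-1}2\bigr)}\,b_{(0,k)}t^k=\int_0^1\bigl(1-\tau+t\tau(e_2^{m/2}+\tau e_m')\bigr)^{\frac{C-\delta-1}2}\tau^{-C-1}\,d\tau .$$ Here $b_{(0,k)}$ is specialized at $(c_1,c_2)$, $1/\Gamma=0$ at the poles of $\Gamma$, and the right-hand side is the formal power series whose coefficient of $t^k$ is the analytic continuation in the parameters (i.e. the integrals $\int_0^1\tau^{x-1}(1-\tau)^{y-1}d\tau$ are understood as $\Gamma(x)\Gamma(y)/\Gamma(x+y)$) of $$\int_0^1\binom{\frac{C-\delta-1}2}{k}(1-\tau)^{\frac{C-\delta-1}2-k}\bigl(\tau(e_2^{m/2}+\tau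 e_m')\bigr)^k\tau^{-C-1}\,d\tau .$$ For every $k$ and all $(c_1,c_2)\in\mathbb C^2$ with $\operatorname{Re}C<0$ and $\operatorname{Re}\frac{C-\delta-1}2>k-1$, where the last integral converges, its value at every point $(z,\bar z)=v\in\mathbb C^2$ equals that of the coefficient of $t^k$ on the left-hand side. 2. Equivalently, for all $k\ge0$, in the field of fractions of $\mathbb C(c_1,c_2)\otimes S(V)$, $$b_{(0,k)}=\frac{e_2^{mk/2}}{k!\binom{2k-C-1}{k}}\,P_k^{\left(-\frac{C+\delta+1}2,\,-\frac{C-\delta+1}2\right)}\!\left(\frac{e_m}{2e_2^{m/2}}\right),$$ where $P_k^{(a,b)}(y)=\frac1{k!}\sum_{j=0}^k\binom kj(k+a+b+1)_j\,(a+j+1)_{k-j}\bigl(\frac{y-1}2\bigr)^j$ is the Jacobi polynomial, $(x)_j=x(x+1)\cdots(x+j-1)$. -/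

import Mathlib

open MvPolynomial

noncomputable section

namespace Dihedral

section Dunkl

/- `K` is the field of parameters (an extension of `ℂ`). The space `V = ℂ²` has the basis
`z, z̄`, where `z = x₁ + i x₂`, `z̄ = x₁ - i x₂` for an orthonormal basis `x₁, x₂` of `V_ℝ`, so that
`(z, z) = (z̄, z̄) = 0` and `(z, z̄) = 2`. The algebra `K ⊗ S(V)` is `MvPolynomial (Fin 2) K`, with
`X 0 = z` and `X 1 = z̄`. -/

variable (K : Type*) [Field K] [Algebra ℂ K] (m : ℕ) [NeZero m]

/-- The root of unity `ζ ^ j`, where `ζ = exp (2πi / m)`. -/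
def zeta (j : ZMod m) : K := algebraMap ℂ K (ZMod.stdAddChar j)

theorem zeta_add (i j : ZMod m) : zeta K m (i + j) = zeta K m i * zeta K m j := by
  simp [zeta, AddChar.map_add_eq_mul]

theorem zeta_zero : zeta K m 0 = 1 := by
  simp [zeta]

/-- The action of an element of the dihedral group of order `2m`: the rotation `r j` sends
`z ↦ ζ ^ j z`, `z̄ ↦ ζ ^ (-j) z̄`, the reflection `s_j = sr j` sends
`z ↦ ζ ^ j z̄`, `z̄ ↦ ζ ^ (-j) z`. -/
def act : DihedralGroup m → (MvPolynomial (Fin 2) K →ₐ[K] MvPolynomial (Fin 2) K)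
  | .r j => aeval ![C (zeta K m j) * X 0, C (zeta K m (-j)) * X 1]
  | .sr j => aeval ![C (zeta K m j) * X 1, C (zeta K m (-j)) * X 0]

/-- The action of the dihedral group on `K ⊗ S(V)` by algebra endomorphisms. -/
def action : DihedralGroup m →* (MvPolynomial (Fin 2) K →ₐ[K] MvPolynomial (Fin 2) K) where
  toFun := act K m
  map_one' := by
    apply MvPolynomial.algHom_ext
    intro i
    rw [← DihedralGroup.r_zero]
    fin_cases i <;> simp [act, zeta_zero]
  map_mul' := by
    intro g h
    apply MvPolynomial.algHom_ext
    intro i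
    rcases g with a | a <;> rcases h with b | b <;> fin_cases i <;>
      simp [act, sub_eq_add_neg, zeta_add, MvPolynomial.algebraMap_eq] <;> ring

/-- The algebra of invariants of the dihedral group. -/
def invariants : Subalgebra K (MvPolynomial (Fin 2) K) where
  carrier := {f | ∀ g, action K m g f = f}
  mul_mem' := by
    intro a b ha hb g
    rw [map_mul, ha g, hb g]
  add_mem' := by
    intro a b ha hb g
    rw [map_add, ha g, hb g]
  algebraMap_mem' := by
    intro r g
    exact AlgHom.commutes _ r

/-- The root `α_j = z - ζ ^ j z̄` of the reflection `s_j`. -/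
def root (j : ZMod m) : MvPolynomial (Fin 2) K := X 0 - C (zeta K m j) * X 1

theorem root_dvd (j : ZMod m) (f : MvPolynomial (Fin 2) K) :
    root K m j ∣ f - action K m (.sr j) f := by
  rw [← Ideal.mem_span_singleton, ← Ideal.Quotient.eq]
  have key : (Ideal.Quotient.mkₐ K (Ideal.span {root K m j})) =
      (Ideal.Quotient.mkₐ K (Ideal.span {root K m j})).comp (action K m (.sr j)) := by
    apply MvPolynomial.algHom_ext
    intro i
    simp only [AlgHom.comp_apply, Ideal.Quotient.mkₐ_eq_mk]
    rw [Ideal.Quotient.eq, Ideal.mem_span_singleton]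
    fin_cases i
    · simp [action, act, root]
    · refine ⟨-C (zeta K m (-j)), ?_⟩
      have h : (C (zeta K m j) * C (zeta K m (-j)) : MvPolynomial (Fin 2) K) = 1 := by
        rw [← C_mul, ← zeta_add, add_neg_cancel, zeta_zero, C_1]
      simp only [action, act, root, MonoidHom.coe_mk, OneHom.coe_mk, aeval_X]
      simp only [Fin.mk_one, Matrix.cons_val_one, Matrix.cons_val_fin_one]
      linear_combination (-X 1) * h
  exact DFunLike.congr_fun key f

variable {K m}

/-- The polynomial `(f - s_j f) / α_j`. -/
def divDiff (j : ZMod m) (f : MvPolynomial (Fin 2) K) : MvPolynomial (Fin 2) K :=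
  (root_dvd K m j f).choose

theorem root_mul_divDiff (j : ZMod m) (f : MvPolynomial (Fin 2) K) :
    root K m j * divDiff j f = f - action K m (.sr j) f :=
  (root_dvd K m j f).choose_spec.symm

/-- The Dunkl operator `∇_y f = ∂_y f - ∑_s c(s) ⟨y, α_s⟩ (f - s f) / α_s`, where `c j` is the
parameter `c(s_j)` and the functional `y` on `V` is given by its values `y 0 = ⟨y, z⟩`,
`y 1 = ⟨y, z̄⟩`. -/
def dunkl (c : ZMod m → K) (y : Fin 2 → K) (f : MvPolynomial (Fin 2) K) :
    MvPolynomial (Fin 2) K :=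
  C (y 0) * pderiv 0 f + C (y 1) * pderiv 1 f -
    ∑ j : ZMod m, C (c j * (y 0 - zeta K m j * y 1)) * divDiff j f

/-- `∇_p f`, where `p ∈ K ⊗ S(V)` is regarded as an element of `K ⊗ S(V*)` by means of the scalar
product: `z` becomes the functional `(z, ·)`, with values `0, 2` on `z, z̄`, and `z̄` becomes
`(z̄, ·)`, with values `2, 0`. (Dunkl operators commute, so the order of the factors in a monomial
is irrelevant.) -/
def nabla (c : ZMod m → K) (p f : MvPolynomial (Fin 2) K) : MvPolynomial (Fin 2) K :=
  ∑ d ∈ p.support, C (p.coeff d) * (dunkl c ![0, 2])^[d 0] ((dunkl c ![2, 0])^[d 1] f)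

/-- The bilinear form `(f, g)_c = [∇_f g]_0`. -/
def form (c : ZMod m → K) (f g : MvPolynomial (Fin 2) K) : K :=
  constantCoeff (nabla c f g)

end Dunkl

section Canonical

/-- The inverse lexicographic order on exponents: the last non-zero coordinate of `a - a'` is
positive. -/
def Prec (a' a : ℕ × ℕ) : Prop := a'.2 < a.2 ∨ (a'.2 = a.2 ∧ a'.1 < a.1)

/-- `u₁, u₂` is a homogeneous generating set of the algebra `S(V)^W` over `ℂ`, listed by degree
(the degrees are `2 < m`). -/
def IsGenerators (m : ℕ) [NeZero m] (u₁ u₂ : MvPolynomial (Fin 2) ℂ) : Prop :=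
  u₁.IsHomogeneous 2 ∧ u₂.IsHomogeneous m ∧ Algebra.adjoin ℂ {u₁, u₂} = invariants ℂ m

variable {K : Type*} [Field K] [Algebra ℂ K] {m : ℕ} [NeZero m]

/-- The monomial `u ^ a = u₁ ^ a₁ u₂ ^ a₂`, regarded as an element of `K ⊗ S(V)`. -/
def monom (K : Type*) [Field K] [Algebra ℂ K] (u₁ u₂ : MvPolynomial (Fin 2) ℂ) (a : ℕ × ℕ) :
    MvPolynomial (Fin 2) K :=
  MvPolynomial.map (algebraMap ℂ K) (u₁ ^ a.1 * u₂ ^ a.2)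

/-- `b` is a canonical invariant `b_a` for the parameters `c`: a homogeneous `W`-invariant such that
for every homogeneous generating set `u` of `S(V)^W`, `b ∈ ℂˣ u ^ a + ∑_{a' ≺ a} K u ^ a'` and
`(u ^ a', b)_c = 0` for all `a' ≺ a`. -/
def IsCanonical (c : ZMod m → K) (a : ℕ × ℕ) (b : MvPolynomial (Fin 2) K) : Prop :=
  (∃ d, b.IsHomogeneous d) ∧ b ∈ invariants K m ∧
    ∀ u₁ u₂ : MvPolynomial (Fin 2) ℂ, IsGenerators m u₁ u₂ →
      (∃ r : ℂ, r ≠ 0 ∧ b - r • monom K u₁ u₂ a ∈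
        Submodule.span K {p | ∃ a', Prec a' a ∧ p = monom K u₁ u₂ a'}) ∧
      ∀ a', Prec a' a → form c (monom K u₁ u₂ a') b = 0

/-- `b k` is, for every `k`, the canonical invariant `b_{(0,k)}`, which is unique up to a non-zero
complex factor. -/
def IsCanonicalFamily (c : ZMod m → K) (b : ℕ → MvPolynomial (Fin 2) K) : Prop :=
  ∀ k, IsCanonical c (0, k) (b k) ∧
    ∀ b', IsCanonical c (0, k) b' → ∃ r : ℂ, r ≠ 0 ∧ b' = r • b k

/-- `e₂ = z z̄`. -/
def e2 (F : Type*) [Field F] : MvPolynomial (Fin 2) F := X 0 * X 1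

/-- `e_m = z ^ m + z̄ ^ m`. -/
def em (F : Type*) [Field F] (m : ℕ) : MvPolynomial (Fin 2) F := X 0 ^ m + X 1 ^ m

/-- `e'_m = e_m / 4 - e₂ ^ (m/2) / 2`, for even `m`. -/
def em' (m : ℕ) : MvPolynomial (Fin 2) ℂ := C (1 / 4) * em ℂ m - C (1 / 2) * e2 ℂ ^ (m / 2)

end Canonical

section Parameters

/-- The field `ℂ(c₁, c₂)` of rational functions of two parameters. -/
abbrev Param : Type := FractionRing (MvPolynomial (Fin 2) ℂ)

/-- The formal parameter `c₁ = c(s₁)`. -/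
def par1 : Param := algebraMap (MvPolynomial (Fin 2) ℂ) Param (X 0)

/-- The formal parameter `c₂ = c(s₂)`. -/
def par2 : Param := algebraMap (MvPolynomial (Fin 2) ℂ) Param (X 1)

/-- For even `m`, the `W`-invariant function on reflections with values `c₁` on the conjugacy class
of `s₁` (the `s_j` with odd `j`) and `c₂` on that of `s₂` (the `s_j` with even `j`). -/
def twoParams (m : ℕ) : ZMod m → Param := fun j => if Even j.val then par2 else par1

/-- The rational function `x` has no pole at `γ`. -/
def RegularAt (γ : Fin 2 → ℂ) (x : Param) : Prop :=
  MvPolynomial.eval γ (IsFractionRing.den (MvPolynomial (Fin 2) ℂ) x : MvPolynomial (Fin 2) ℂ) ≠ 0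

/-- The value at `γ` of a rational function `x` which is regular at `γ`. -/
def valueAt (γ : Fin 2 → ℂ) (x : Param) : ℂ :=
  MvPolynomial.eval γ (IsFractionRing.num (MvPolynomial (Fin 2) ℂ) x) /
    MvPolynomial.eval γ (IsFractionRing.den (MvPolynomial (Fin 2) ℂ) x : MvPolynomial (Fin 2) ℂ)

/-- The specialization of a polynomial with coefficients in `ℂ(c₁, c₂)` at `c = γ`. -/
def specialize (γ : Fin 2 → ℂ) (b : MvPolynomial (Fin 2) Param) : MvPolynomial (Fin 2) ℂ :=
  ∑ d ∈ b.support, monomial d (valueAt γ (b.coeff d))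

end Parameters

section Special

/-- The analytic continuation in `x, y` of `∫₀¹ τ ^ (x - 1) (1 - τ) ^ (y - 1) p(τ) dτ`, where `p` is
a polynomial in `τ` with coefficients in a `ℂ`-algebra: each
`∫₀¹ τ ^ (x + j - 1) (1 - τ) ^ (y - 1) dτ` is continued as the Beta function `B(x + j, y)`. -/
def eulerIntegral {A : Type*} [CommRing A] [Algebra ℂ A] (x y : ℂ) (p : Polynomial A) : A :=
  ∑ j ∈ p.support,
    (Complex.Gamma (x + j) * Complex.Gamma y / Complex.Gamma (x + j + y)) • p.coeff j

theorem eulerIntegral_eq_integral (x y : ℂ) (hx : 0 < x.re) (hy : 0 < y.re) (p : Polynomial ℂ) :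
    eulerIntegral x y p =
      ∫ τ in (0 : ℝ)..1, (τ : ℂ) ^ (x - 1) * (1 - τ : ℂ) ^ (y - 1) * p.eval (τ : ℂ) := by
  have hre : ∀ j : ℕ, 0 < (x + j).re := fun j => by
    simp only [Complex.add_re, Complex.natCast_re]
    positivity
  have hint : ∀ j ∈ p.support, IntervalIntegrable
      (fun τ : ℝ => p.coeff j * ((τ : ℂ) ^ (x + j - 1) * (1 - τ : ℂ) ^ (y - 1)))
      MeasureTheory.volume 0 1 :=
    fun j _ => (Complex.betaIntegral_convergent (hre j) hy).const_mul _
  have hcongr : ∫ τ in (0 : ℝ)..1, (τ : ℂ) ^ (x - 1) * (1 - τ : ℂ) ^ (y - 1) * p.eval (τ : ℂ) =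
      ∫ τ in (0 : ℝ)..1, ∑ j ∈ p.support,
        p.coeff j * ((τ : ℂ) ^ (x + j - 1) * (1 - τ : ℂ) ^ (y - 1)) := by
    refine intervalIntegral.integral_congr_ae (Filter.Eventually.of_forall fun τ hτ => ?_)
    rw [Set.uIoc_of_le zero_le_one] at hτ
    have h0 : (τ : ℂ) ≠ 0 := by exact_mod_cast hτ.1.ne'
    rw [Polynomial.eval_eq_sum, Polynomial.sum, Finset.mul_sum]
    refine Finset.sum_congr rfl fun j _ => ?_
    rw [show x + j - 1 = (x - 1) + j by ring, Complex.cpow_add _ _ h0, Complex.cpow_natCast]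
    ring
  rw [hcongr, intervalIntegral.integral_finsetSum hint, eulerIntegral]
  refine Finset.sum_congr rfl fun j _ => ?_
  rw [intervalIntegral.integral_const_mul, Complex.Gamma_mul_Gamma_eq_betaIntegral (hre j) hy,
    mul_div_cancel_left₀ _ (Complex.Gamma_ne_zero_of_re_pos (by
      rw [Complex.add_re]; exact add_pos (hre j) hy)), smul_eq_mul, mul_comm]
  rfl

/-- The integral `∫₀¹ (1 - τ + t τ (P + τ Q)) ^ r τ ^ (s - 1) dτ` as a formal power series in `t`:
the power is expanded by the binomial formula as
`∑_k binom(r, k) (1 - τ) ^ (r - k) (τ (P + τ Q)) ^ k t ^ k`, and the coefficients are integrated,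
with analytic continuation in `r, s`. -/
def eulerSeries {A : Type*} [CommRing A] [Algebra ℂ A] (r s : ℂ) (P Q : A) : PowerSeries A :=
  PowerSeries.mk fun k => Ring.choose r k •
    eulerIntegral s (r - k + 1)
      ((Polynomial.X * (Polynomial.C P + Polynomial.X * Polynomial.C Q)) ^ k)

/-- The Jacobi polynomial
`P_n^{(a,b)}(y) = (1/n!) ∑_j binom(n, j) (n+a+b+1)_j (a+j+1)_{n-j} ((y-1)/2) ^ j`
with parameters in a field. -/
def jacobi {F : Type*} [Field F] (n : ℕ) (a b : F) : Polynomial F :=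
  Polynomial.C ((n.factorial : F)⁻¹) * ∑ j ∈ Finset.range (n + 1),
    Polynomial.C ((n.choose j : F) * (ascPochhammer F j).eval (n + a + b + 1) *
      (ascPochhammer F (n - j)).eval (a + j + 1)) *
    (Polynomial.C (2⁻¹ : F) * (Polynomial.X - 1)) ^ j

end Special

end Dihedral

end

/-! The canonical invariants `b_{(0,k)}` are the harmonic ones. Let `b` be an invariant of degree
`mk` with leading term a multiple of `e_m ^ k`, killed by the Dunkl Laplacian `∇_{e₂}`. The
monomials below `(0,k)` are `u₁ ^ i u₂ ^ l` with `l < k`. If `i > 0`, the monomial is `e₂ h` for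
some `h`, and pairing it with `b` gives the constant term of `∇_h ∇_{e₂} b = 0`; this uses that
Dunkl operators commute (`dunkl_comm`). If `i = 0`, its degree `ml` is less than `mk`, and `ml`
Dunkl operators leave a polynomial of positive degree. Any other generating set is a triangular
change of `e₂, e_m` (`IsGenerators.exists_eq`), so the choice of generators is immaterial
(`isCanonical_of_lap_eq_zero`).

For uniqueness, the difference of two normalized candidates lies in the span of the lower monomials
and is orthogonal to it. The form is nondegenerate there: its Gram determinant is a polynomial in
the parameters, and at `c = 0` it does not vanish, because the form is then positive definite on
invariants after complex conjugation of one argument (`eq_zero_of_forall_form_eq_zero`).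

It remains to write down harmonic invariants. Divided differences are linear over invariants, so on
invariants the Laplacian is a second-order operator, determined by its values and its gradient
products on two generators (`lap_mul`). For equal parameters the operator sends `e_m ^ a (e₂ ^ m) ^
l` to a fixed factor times two neighbouring monomials; for two parameters the same is true of `e'_m
^ a (e₂ ^ (m/2)) ^ l`, where `e'_m = ((z ^ (m/2) - z̄ ^ (m/2)) / 2) ^ 2`. Harmonicity thus becomes a
two-term recurrence, solved by the binomial coefficients of `(1 + e_m t + e₂ ^ m t ^ 2) ^ c` in the
first case (`choose_recurrence`) and by quotients of Pochhammer symbols in the second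
(`jacobiCoeff_recurrence`). The latter are the coefficients of Jacobi polynomials, and up to a
common Gamma factor they are Beta integrals, which yields the integral generating function
(`Gamma_mul_jacobiCoeff`). -/

noncomputable section

namespace Dihedral

/-! ### The dihedral action and divided differences -/

section Basic

variable {K : Type*} [Field K] [Algebra ℂ K] {m : ℕ} [NeZero m]

theorem zeta_mul_zeta_neg (j : ZMod m) : zeta K m j * zeta K m (-j) = 1 := by
  rw [← zeta_add, add_neg_cancel, zeta_zero]

theorem zeta_ne_zero (j : ZMod m) : zeta K m j ≠ 0 :=
  left_ne_zero_of_mul_eq_one (zeta_mul_zeta_neg j)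

theorem zeta_natCast_mul (n : ℕ) (j : ZMod m) : zeta K m (n * j) = zeta K m j ^ n := by
  rw [zeta, zeta, ← nsmul_eq_mul, AddChar.map_nsmul_eq_pow, map_pow]

theorem zeta_pow_card (j : ZMod m) : zeta K m j ^ m = 1 := by
  rw [← zeta_natCast_mul, CharP.cast_eq_zero, zero_mul, zeta_zero]

theorem action_sr_X0 (j : ZMod m) :
    action K m (.sr j) (X 0) = C (zeta K m j) * X 1 := by
  simp [action, act]

theorem action_sr_X1 (j : ZMod m) :
    action K m (.sr j) (X 1) = C (zeta K m (-j)) * X 0 := by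
  simp [action, act]

theorem action_r_X0 (j : ZMod m) :
    action K m (.r j) (X 0) = C (zeta K m j) * X 0 := by
  simp [action, act]

theorem action_r_X1 (j : ZMod m) :
    action K m (.r j) (X 1) = C (zeta K m (-j)) * X 1 := by
  simp [action, act]

theorem action_C (g : DihedralGroup m) (a : K) : action K m g (C a) = C a :=
  (action K m g).commutes a

theorem root_ne_zero (j : ZMod m) : root K m j ≠ 0 := by
  intro h
  have := congrArg (coeff (Finsupp.single 0 1)) h
  rw [root, coeff_sub, coeff_X, coeff_C_mul, coeff_X] at this
  simp [Finsupp.single_left_inj] at this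

/-- The quotient is defined by choice, but the polynomial ring is a domain, so it is determined by
its product with the root. All properties of `divDiff` are derived from this. -/
theorem divDiff_eq_of_root_mul {j : ZMod m} {f g : MvPolynomial (Fin 2) K}
    (h : root K m j * g = f - action K m (.sr j) f) : divDiff j f = g :=
  mul_left_cancel₀ (root_ne_zero j) ((root_mul_divDiff j f).trans h.symm)

theorem divDiff_add (j : ZMod m) (f g : MvPolynomial (Fin 2) K) :
    divDiff j (f + g) = divDiff j f + divDiff j g := by
  apply divDiff_eq_of_root_mul
  rw [mul_add, root_mul_divDiff, root_mul_divDiff, map_add]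
  ring

theorem divDiff_mul_of_action_eq {j : ZMod m} {f : MvPolynomial (Fin 2) K}
    (hf : action K m (.sr j) f = f) (g : MvPolynomial (Fin 2) K) :
    divDiff j (f * g) = f * divDiff j g := by
  apply divDiff_eq_of_root_mul
  rw [mul_left_comm, root_mul_divDiff, map_mul, hf]
  ring

theorem divDiff_C_mul (j : ZMod m) (a : K) (g : MvPolynomial (Fin 2) K) :
    divDiff j (C a * g) = C a * divDiff j g :=
  divDiff_mul_of_action_eq (action_C _ a) g

theorem divDiff_eq_zero {j : ZMod m} {f : MvPolynomial (Fin 2) K}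
    (hf : action K m (.sr j) f = f) : divDiff j f = 0 := by
  apply divDiff_eq_of_root_mul
  rw [hf, sub_self, mul_zero]

theorem divDiff_X0_mul (j : ZMod m) (f : MvPolynomial (Fin 2) K) :
    divDiff j (X 0 * f) = X 0 * divDiff j f + action K m (.sr j) f := by
  apply divDiff_eq_of_root_mul
  rw [mul_add, mul_left_comm, root_mul_divDiff, map_mul, action_sr_X0, root]
  ring

theorem divDiff_X1_mul (j : ZMod m) (f : MvPolynomial (Fin 2) K) :
    divDiff j (X 1 * f) = X 1 * divDiff j f - C (zeta K m (-j)) * action K m (.sr j) f := by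
  apply divDiff_eq_of_root_mul
  have h : (C (zeta K m j) * C (zeta K m (-j)) : MvPolynomial (Fin 2) K) = 1 := by
    rw [← C_mul, zeta_mul_zeta_neg, C_1]
  rw [mul_sub, mul_left_comm, root_mul_divDiff, map_mul, action_sr_X1, root]
  linear_combination (X 1 * action K m (.sr j) f) * h

/-- The coefficients `κ` with `x_i - s_j x_i = κ α_j`. -/
def corootCoeff (K : Type*) [Field K] [Algebra ℂ K] {m : ℕ} [NeZero m] (j : ZMod m) : Fin 2 → K :=
  ![1, -zeta K m (-j)]

theorem divDiff_X_mul (j : ZMod m) (i : Fin 2) (f : MvPolynomial (Fin 2) K) :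
    divDiff j (X i * f) = X i * divDiff j f + C (corootCoeff K j i) * action K m (.sr j) f := by
  fin_cases i
  · simpa [corootCoeff] using divDiff_X0_mul j f
  · simpa [corootCoeff, sub_eq_add_neg] using divDiff_X1_mul j f

/-- Conjugating `s_i` by `s_j` gives `s_{2j-i}`, so a root goes to a multiple of the root of that
reflection. -/
theorem action_sr_root (i j : ZMod m) :
    action K m (.sr j) (root K m i) = -C (zeta K m (i - j)) * root K m (2 * j - i) := by
  have h : (C (zeta K m (i - j)) * C (zeta K m (2 * j - i)) : MvPolynomial (Fin 2) K) =
      C (zeta K m j) := by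
    rw [← C_mul, ← zeta_add]
    congr 2
    ring
  have h2 : (C (zeta K m i) * C (zeta K m (-j)) : MvPolynomial (Fin 2) K) =
      C (zeta K m (i - j)) := by
    rw [← C_mul, ← zeta_add, sub_eq_add_neg]
  rw [root, map_sub, map_mul, action_C, action_sr_X0, action_sr_X1, root]
  linear_combination (-X 1) * h - X 0 * h2

theorem action_sr_sr (i j : ZMod m) (f : MvPolynomial (Fin 2) K) :
    action K m (.sr j) (action K m (.sr i) f) =
      action K m (.sr (2 * j - i)) (action K m (.sr j) f) := by
  rw [← AlgHom.mul_apply, ← AlgHom.mul_apply, ← map_mul, ← map_mul, DihedralGroup.sr_mul_sr,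
    DihedralGroup.sr_mul_sr]
  congr 3
  ring

theorem action_sr_divDiff (i j : ZMod m) (f : MvPolynomial (Fin 2) K) :
    action K m (.sr j) (divDiff i f) =
      -C (zeta K m (j - i)) * divDiff (2 * j - i) (action K m (.sr j) f) := by
  have h : (C (zeta K m (i - j)) * C (zeta K m (j - i)) : MvPolynomial (Fin 2) K) = 1 := by
    rw [← C_mul, ← neg_sub i j, zeta_mul_zeta_neg, C_1]
  have h1 := congrArg (action K m (.sr j)) (root_mul_divDiff i f)
  rw [map_mul, map_sub, action_sr_root, action_sr_sr, ← root_mul_divDiff] at h1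
  have h2 : root K m (2 * j - i) * (-C (zeta K m (i - j)) * action K m (.sr j) (divDiff i f)) =
      root K m (2 * j - i) * divDiff (2 * j - i) (action K m (.sr j) f) := by
    linear_combination h1
  have h3 := mul_left_cancel₀ (root_ne_zero _) h2
  linear_combination (-C (zeta K m (j - i))) * h3 - (action K m (.sr j) (divDiff i f)) * h

theorem pderiv_action_sr (j : ZMod m) (f : MvPolynomial (Fin 2) K) :
    pderiv 0 (action K m (.sr j) f) = C (zeta K m (-j)) * action K m (.sr j) (pderiv 1 f) ∧
    pderiv 1 (action K m (.sr j) f) = C (zeta K m j) * action K m (.sr j) (pderiv 0 f) := by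
  induction f using MvPolynomial.induction_on with
  | C a => simp
  | add p q hp hq =>
    simp only [map_add, hp.1, hp.2, hq.1, hq.2]
    constructor <;> ring
  | mul_X p i hp =>
    fin_cases i
    · simp [action_sr_X0, hp.1, hp.2, pderiv_X]
      constructor <;> ring
    · simp [action_sr_X1, hp.1, hp.2, pderiv_X]
      constructor <;> ring

theorem action_sr_pderiv_zero (j : ZMod m) (f : MvPolynomial (Fin 2) K) :
    action K m (.sr j) (pderiv 0 f) = C (zeta K m (-j)) * pderiv 1 (action K m (.sr j) f) := by
  have h : (C (zeta K m j) * C (zeta K m (-j)) : MvPolynomial (Fin 2) K) = 1 := by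
    rw [← C_mul, zeta_mul_zeta_neg, C_1]
  rw [(pderiv_action_sr j f).2]
  linear_combination (-action K m (.sr j) (pderiv 0 f)) * h

theorem action_sr_pderiv_one (j : ZMod m) (f : MvPolynomial (Fin 2) K) :
    action K m (.sr j) (pderiv 1 f) = C (zeta K m j) * pderiv 0 (action K m (.sr j) f) := by
  have h : (C (zeta K m j) * C (zeta K m (-j)) : MvPolynomial (Fin 2) K) = 1 := by
    rw [← C_mul, zeta_mul_zeta_neg, C_1]
  rw [(pderiv_action_sr j f).1]
  linear_combination (-action K m (.sr j) (pderiv 1 f)) * h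

end Basic

/-! ### Commutativity of the Dunkl operators -/

section Commute

variable {K : Type*} [Field K] [Algebra ℂ K] {m : ℕ} [NeZero m] (c : ZMod m → K) (y : Fin 2 → K)

theorem dunkl_add (f g : MvPolynomial (Fin 2) K) :
    dunkl c y (f + g) = dunkl c y f + dunkl c y g := by
  simp only [dunkl, divDiff_add, map_add, mul_add, Finset.sum_add_distrib]
  ring

theorem dunkl_C_mul (a : K) (f : MvPolynomial (Fin 2) K) :
    dunkl c y (C a * f) = C a * dunkl c y f := by
  simp only [dunkl, divDiff_C_mul, pderiv_C_mul, mul_sub, mul_add,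
    Finset.mul_sum]
  simp only [mul_left_comm (C a)]

/-- The Dunkl operator as a linear map. -/
def dunklEnd : Module.End K (MvPolynomial (Fin 2) K) where
  toFun := dunkl c y
  map_add' := dunkl_add c y
  map_smul' a f := by
    simp only [MvPolynomial.smul_eq_C_mul, dunkl_C_mul, RingHom.id_apply]

theorem dunkl_C (a : K) : dunkl c y (C a) = 0 := by
  simp [dunkl, divDiff_eq_zero (action_C _ a)]

/-- The commutator of a Dunkl operator with a coordinate contains only group elements and no divided
difference, which is what makes induction on the degree possible. -/
theorem dunkl_X_mul (i : Fin 2) (f : MvPolynomial (Fin 2) K) :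
    dunkl c y (X i * f) = X i * dunkl c y f + C (y i) * f -
      ∑ j : ZMod m, C (c j * (y 0 - zeta K m j * y 1) * corootCoeff K j i) *
        action K m (.sr j) f := by
  have h : C (y 0) * pderiv 0 (X i * f) + C (y 1) * pderiv 1 (X i * f) =
      X i * (C (y 0) * pderiv 0 f + C (y 1) * pderiv 1 f) + C (y i) * f := by
    fin_cases i <;> simp [pderiv_X] <;> ring
  rw [dunkl, h, dunkl, mul_sub, Finset.mul_sum]
  have h2 : ∑ j : ZMod m, C (c j * (y 0 - zeta K m j * y 1)) * divDiff j (X i * f) =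
      ∑ j : ZMod m, X i * (C (c j * (y 0 - zeta K m j * y 1)) * divDiff j f) +
      ∑ j : ZMod m, C (c j * (y 0 - zeta K m j * y 1) * corootCoeff K j i) *
        action K m (.sr j) f := by
    rw [← Finset.sum_add_distrib]
    refine Finset.sum_congr rfl fun j _ => ?_
    rw [divDiff_X_mul, C_mul (a := c j * _)]
    ring
  rw [h2]
  ring

variable {c}

/-- Equivariance of the Dunkl operators. The hypothesis `hc` says that `c` is constant on conjugacy
classes; the substitution `i ↦ 2j - i` permutes the sum over reflections. -/
theorem action_sr_dunkl (hc : ∀ i j, c (2 * j - i) = c i) (j : ZMod m)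
    (f : MvPolynomial (Fin 2) K) :
    action K m (.sr j) (dunkl c y f) =
      dunkl c ![zeta K m j * y 1, zeta K m (-j) * y 0] (action K m (.sr j) f) := by
  rw [dunkl, dunkl, map_sub, map_add, map_mul, map_mul, action_C, action_C,
    action_sr_pderiv_zero, action_sr_pderiv_one, map_sum]
  simp only [Matrix.cons_val_zero, Matrix.cons_val_one, C_mul]
  have hs : ∑ i : ZMod m, action K m (.sr j)
        (C (c i) * C (y 0 - zeta K m i * y 1) * divDiff i f) =
      ∑ i : ZMod m, C (c i) * C (zeta K m j * y 1 - zeta K m i * (zeta K m (-j) * y 0)) *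
        divDiff i (action K m (.sr j) f) := by
    have hinv : Function.Involutive (fun i : ZMod m => 2 * j - i) := fun i => sub_sub_cancel _ _
    refine Fintype.sum_equiv hinv.toPerm _ _ fun i => ?_
    rw [Function.Involutive.coe_toPerm, map_mul, map_mul, action_C, action_C, action_sr_divDiff,
      hc i j]
    have e : (y 0 - zeta K m i * y 1) * zeta K m (j - i) =
        -(zeta K m j * y 1 - zeta K m (2 * j - i) * (zeta K m (-j) * y 0)) := by
      have e1 : zeta K m i * zeta K m (j - i) = zeta K m j := by
        rw [← zeta_add, add_sub_cancel]
      have e2 : zeta K m (2 * j - i) * zeta K m (-j) = zeta K m (j - i) := by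
        rw [← zeta_add]
        congr 1
        ring
      linear_combination (-y 1) * e1 - y 0 * e2
    have e' := congrArg (C (σ := Fin 2)) e
    rw [C_mul, C_neg] at e'
    linear_combination (-C (c i) * divDiff (2 * j - i) (action K m (.sr j) f)) * e'
  rw [hs]
  ring

theorem dunkl_sub_smul {y' w : Fin 2 → K} {a : K} (h : y - y' = a • w)
    (f : MvPolynomial (Fin 2) K) : dunkl c y f - dunkl c y' f = C a * dunkl c w f := by
  have h0 : y 0 = y' 0 + a * w 0 := by
    have := congrFun h 0
    simp only [Pi.sub_apply, Pi.smul_apply, smul_eq_mul] at this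
    linear_combination this
  have h1 : y 1 = y' 1 + a * w 1 := by
    have := congrFun h 1
    simp only [Pi.sub_apply, Pi.smul_apply, smul_eq_mul] at this
    linear_combination this
  have hs : ∑ j : ZMod m, C (c j * (y 0 - zeta K m j * y 1)) * divDiff j f =
      ∑ j : ZMod m, C (c j * (y' 0 - zeta K m j * y' 1)) * divDiff j f +
      C a * ∑ j : ZMod m, C (c j * (w 0 - zeta K m j * w 1)) * divDiff j f := by
    rw [Finset.mul_sum, ← Finset.sum_add_distrib]
    refine Finset.sum_congr rfl fun j _ => ?_
    rw [h0, h1]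
    simp only [C_mul, C_add, C_sub]
    ring
  rw [dunkl, dunkl, dunkl, hs, h0, h1]
  simp only [C_mul, C_add]
  ring

/-- By equivariance the defect is the Dunkl operator of `y - s_j y`, a multiple of the fixed
functional `![1, -ζ ^ (-j)]`. -/
theorem dunkl_action_sr (hc : ∀ i j, c (2 * j - i) = c i) (j : ZMod m)
    (f : MvPolynomial (Fin 2) K) :
    dunkl c y (action K m (.sr j) f) = action K m (.sr j) (dunkl c y f) +
      C (y 0 - zeta K m j * y 1) *
        dunkl c ![1, -zeta K m (-j)] (action K m (.sr j) f) := by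
  rw [action_sr_dunkl y hc, ← dunkl_sub_smul y (y' := ![zeta K m j * y 1, zeta K m (-j) * y 0])]
  · ring
  · ext i
    fin_cases i
    · simp
    · have := zeta_mul_zeta_neg (K := K) j
      simp
      linear_combination (-y 1) * this

theorem dunkl_sum {ι : Type*} (s : Finset ι) (f : ι → MvPolynomial (Fin 2) K) :
    dunkl c y (∑ i ∈ s, f i) = ∑ i ∈ s, dunkl c y (f i) :=
  map_sum (dunklEnd c y) f s

/-- Dunkl operators commute. -/
theorem dunkl_comm (hc : ∀ i j, c (2 * j - i) = c i) (y y' : Fin 2 → K)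
    (f : MvPolynomial (Fin 2) K) : dunkl c y (dunkl c y' f) = dunkl c y' (dunkl c y f) := by
  induction f using MvPolynomial.induction_on with
  | C a => simp only [dunkl_C, ← C_0 (R := K) (σ := Fin 2)]
  | add p q hp hq => simp only [dunkl_add, hp, hq]
  | mul_X f i hf =>
    -- Apart from the term `X i * ∇_y ∇_{y'} f`, covered by the induction hypothesis, the right-hand
    -- side is symmetric in `y` and `y'`.
    have key : ∀ y y' : Fin 2 → K, dunkl c y (dunkl c y' (X i * f)) =
        X i * dunkl c y (dunkl c y' f) + C (y i) * dunkl c y' f + C (y' i) * dunkl c y f -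
        ∑ j : ZMod m, (C (c j * corootCoeff K j i) *
          (C (y 0 - zeta K m j * y 1) * action K m (.sr j) (dunkl c y' f) +
            C (y' 0 - zeta K m j * y' 1) * action K m (.sr j) (dunkl c y f) +
            C (y 0 - zeta K m j * y 1) * C (y' 0 - zeta K m j * y' 1) *
              dunkl c ![1, -zeta K m (-j)] (action K m (.sr j) f))) := by
      intro y y'
      rw [dunkl_X_mul c y', sub_eq_add_neg, ← neg_one_mul, ← C_1, ← C_neg, dunkl_add, dunkl_add,
        dunkl_X_mul, dunkl_C_mul, dunkl_C_mul, dunkl_sum]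
      simp only [dunkl_C_mul, dunkl_action_sr y hc]
      have : ∀ a b d e s t : MvPolynomial (Fin 2) K, s + t = d →
          a + b - s + e + C (-1) * t = a + b + e - d := by
        intro a b d e s t h
        rw [C_neg, C_1, ← h]
        ring
      apply this
      rw [← Finset.sum_add_distrib]
      refine Finset.sum_congr rfl fun j _ => ?_
      simp only [C_mul]
      ring
    rw [mul_comm f, key y y', key y' y, hf]
    refine congrArg₂ _ (by ring) (Finset.sum_congr rfl fun j _ => by ring)

end Commute

/-! ### The bilinear form: harmonicity and degree -/

section Form

variable {K : Type*} [Field K] [Algebra ℂ K] {m : ℕ} [NeZero m] (c : ZMod m → K)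

/-- `∇_p` as a linear function of `p` with values in the linear endomorphisms. -/
def nablaLin : MvPolynomial (Fin 2) K →ₗ[K] Module.End K (MvPolynomial (Fin 2) K) :=
  (basisMonomials (Fin 2) K).constr K
    fun d => dunklEnd c ![0, 2] ^ d 0 * dunklEnd c ![2, 0] ^ d 1

theorem nabla_eq_nablaLin (p f : MvPolynomial (Fin 2) K) : nabla c p f = nablaLin c p f := by
  rw [nablaLin, Module.Basis.constr_apply, Finsupp.sum, LinearMap.sum_apply]
  refine Finset.sum_congr rfl fun d _ => ?_
  rw [LinearMap.smul_apply, smul_eq_C_mul, Module.End.mul_apply, Module.End.pow_apply,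
    Module.End.pow_apply]
  rfl

theorem nablaLin_monomial (d : Fin 2 →₀ ℕ) (a : K) :
    nablaLin c (monomial d a) = a • (dunklEnd c ![0, 2] ^ d 0 * dunklEnd c ![2, 0] ^ d 1) := by
  have h : monomial d a = a • basisMonomials (Fin 2) K d := by
    rw [coe_basisMonomials, smul_monomial, smul_eq_mul, mul_one]
  rw [h, map_smul, nablaLin, Module.Basis.constr_basis]

/-- The bilinear form as a bilinear map. -/
def formLin : MvPolynomial (Fin 2) K →ₗ[K] MvPolynomial (Fin 2) K →ₗ[K] K :=
  (nablaLin c).compr₂ (lcoeff K 0)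

theorem form_eq_formLin (p f : MvPolynomial (Fin 2) K) : form c p f = formLin c p f := by
  rw [form, nabla_eq_nablaLin, constantCoeff_eq]
  rfl

theorem form_monomial (d : Fin 2 →₀ ℕ) (a : K) (f : MvPolynomial (Fin 2) K) :
    form c (monomial d a) f =
      a * coeff 0 ((dunkl c ![0, 2])^[d 0] ((dunkl c ![2, 0])^[d 1] f)) := by
  rw [form, nabla_eq_nablaLin, nablaLin_monomial, LinearMap.smul_apply, Module.End.mul_apply,
    Module.End.pow_apply, Module.End.pow_apply, constantCoeff_eq, coeff_smul, smul_eq_mul]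
  rfl

variable {c}

/-- Multiplication by `e₂` in the first argument is adjoint to `∇_{e₂}`: one factor of each kind is
moved by commutativity until it acts directly on `b`. -/
theorem form_e2_mul_eq_zero (hc : ∀ i j, c (2 * j - i) = c i) {b : MvPolynomial (Fin 2) K}
    (hb : dunkl c ![0, 2] (dunkl c ![2, 0] b) = 0) (h : MvPolynomial (Fin 2) K) :
    form c (e2 K * h) b = 0 := by
  induction h using MvPolynomial.induction_on' with
  | add p q hp hq =>
    rw [form_eq_formLin] at *
    rw [mul_add, map_add, LinearMap.add_apply, hp, hq, add_zero]
  | monomial d a =>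
    have hd : e2 K * monomial d a =
        monomial (Finsupp.single 0 1 + (Finsupp.single 1 1 + d)) a := by
      rw [e2, X, X, mul_assoc, monomial_mul, monomial_mul, one_mul, one_mul]
    have hcomm : Function.Commute (dunkl c ![0, 2]) (dunkl c ![2, 0]) :=
      fun f => dunkl_comm hc _ _ f
    have hz : ∀ n, (dunkl c ![0, 2])^[n] 0 = 0 := fun n => by
      have := map_zero (dunklEnd c ![0, 2] ^ n)
      rwa [Module.End.pow_apply] at this
    have hz' : ∀ n, (dunkl c ![2, 0])^[n] 0 = 0 := fun n => by
      have := map_zero (dunklEnd c ![2, 0] ^ n)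
      rwa [Module.End.pow_apply] at this
    have h0 : (Finsupp.single (0 : Fin 2) 1 + (Finsupp.single 1 1 + d) : Fin 2 →₀ ℕ) 0 =
        d 0 + 1 := by
      simp [add_comm]
    have h1 : (Finsupp.single (0 : Fin 2) 1 + (Finsupp.single 1 1 + d) : Fin 2 →₀ ℕ) 1 =
        d 1 + 1 := by
      simp [add_comm]
    rw [hd, form_monomial, h0, h1, Function.iterate_succ_apply, Function.iterate_succ_apply,
      (hcomm.iterate_right (d 1)) _, hb, hz', hz, coeff_zero, mul_zero]

theorem action_isHomogeneous {n : ℕ} {f : MvPolynomial (Fin 2) K} (hf : f.IsHomogeneous n)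
    (g : DihedralGroup m) : (action K m g f).IsHomogeneous n := by
  have h : ∀ u : Fin 2 → MvPolynomial (Fin 2) K, (∀ i, (u i).IsHomogeneous 1) →
      (MvPolynomial.aeval u f).IsHomogeneous n := fun u hu => by
    simpa using hf.aeval u hu
  rcases g with j | j
  all_goals
    refine h _ fun i => ?_
    fin_cases i <;> exact (isHomogeneous_X _ _).C_mul _

/-- Splitting off one variable and applying the twisted Leibniz rule `divDiff_X_mul` reduces to a
monomial of smaller degree. -/
theorem divDiff_monomial_isHomogeneous (j : ZMod m) (n : ℕ) : ∀ (d : Fin 2 →₀ ℕ),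
    d.degree = n + 1 → (divDiff j (monomial d (1 : K))).IsHomogeneous n := by
  have step : ∀ (n : ℕ) (d : Fin 2 →₀ ℕ), d.degree = n + 1 →
      (∀ d' : Fin 2 →₀ ℕ, d'.degree = n → ∀ {i},
        (X i * divDiff j (monomial d' (1 : K))).IsHomogeneous n) →
      (divDiff j (monomial d (1 : K))).IsHomogeneous n := by
    intro n d hd h
    have hd0 : d ≠ 0 := by
      rintro rfl
      simp at hd
    obtain ⟨i, hi⟩ := Finsupp.ne_iff.1 hd0
    have hle : Finsupp.single i 1 ≤ d := by
      rw [Finsupp.single_le_iff]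
      exact Nat.one_le_iff_ne_zero.2 hi
    obtain ⟨d', rfl⟩ := exists_add_of_le hle
    have hd' : d'.degree = n := by
      rw [map_add, Finsupp.degree_single] at hd
      omega
    rw [← one_mul (1 : K), ← monomial_mul, ← X, divDiff_X_mul]
    exact (h d' hd').add ((action_isHomogeneous (isHomogeneous_monomial _ hd') _).C_mul _)
  induction n with
  | zero =>
    refine fun d hd => step 0 d hd fun d' hd' i => ?_
    rw [(Finsupp.degree_eq_zero_iff d').1 hd', monomial_zero', C_1,
      divDiff_eq_zero (map_one _), mul_zero]
    exact isHomogeneous_zero _ _ _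
  | succ n ih =>
    refine fun d hd => step (n + 1) d hd fun d' hd' i => ?_
    rw [add_comm]
    exact (isHomogeneous_X _ _).mul (ih _ hd')

theorem divDiff_sum (j : ZMod m) {ι : Type*} (s : Finset ι) (f : ι → MvPolynomial (Fin 2) K) :
    divDiff j (∑ i ∈ s, f i) = ∑ i ∈ s, divDiff j (f i) :=
  map_sum (⟨⟨divDiff j, divDiff_eq_zero (map_zero _)⟩, divDiff_add j⟩ :
    MvPolynomial (Fin 2) K →+ MvPolynomial (Fin 2) K) f s

theorem divDiff_isHomogeneous {n : ℕ} {f : MvPolynomial (Fin 2) K} (hf : f.IsHomogeneous (n + 1))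
    (j : ZMod m) : (divDiff j f).IsHomogeneous n := by
  rw [f.as_sum, divDiff_sum]
  refine IsHomogeneous.sum _ _ _ fun d hd => ?_
  rw [← mul_one (coeff d f), ← C_mul_monomial, divDiff_C_mul]
  exact (divDiff_monomial_isHomogeneous j n d (hf.degree_eq_sum_deg_support hd).symm).C_mul _

theorem dunkl_isHomogeneous (y : Fin 2 → K) {n : ℕ} {f : MvPolynomial (Fin 2) K}
    (hf : f.IsHomogeneous (n + 1)) : (dunkl c y f).IsHomogeneous n := by
  refine ((hf.pderiv.C_mul _).add (hf.pderiv.C_mul _)).sub (IsHomogeneous.sum _ _ _ fun j _ => ?_)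
  exact (divDiff_isHomogeneous hf j).C_mul _

theorem iterate_dunkl_isHomogeneous (y : Fin 2 → K) {n k : ℕ} {f : MvPolynomial (Fin 2) K}
    (hf : f.IsHomogeneous (n + k)) : ((dunkl c y)^[k] f).IsHomogeneous n := by
  induction k generalizing f with
  | zero => exact hf
  | succ k ih => exact ih (dunkl_isHomogeneous y hf)

theorem form_eq_zero_of_isHomogeneous {p f : MvPolynomial (Fin 2) K} {a n : ℕ}
    (hp : p.IsHomogeneous a) (hf : f.IsHomogeneous n) (han : a < n) : form c p f = 0 := by
  rw [form_eq_formLin, p.as_sum, map_sum, LinearMap.sum_apply]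
  refine Finset.sum_eq_zero fun d hd => ?_
  have hda := hp.degree_eq_sum_deg_support hd
  change a = d.degree at hda
  rw [Finsupp.degree_eq_sum, Fin.sum_univ_two] at hda
  rw [← form_eq_formLin, form_monomial]
  obtain ⟨e, rfl⟩ := Nat.exists_eq_add_of_lt han
  have h1 : f.IsHomogeneous (e + 1 + d 0 + d 1) := by
    convert hf using 1
    omega
  have h2 := iterate_dunkl_isHomogeneous (c := c) ![0, 2]
    (iterate_dunkl_isHomogeneous (c := c) ![2, 0] h1)
  rw [h2.coeff_eq_zero (by simp), mul_zero]

end Form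

/-! ### The Dunkl Laplacian on invariants -/

section Laplacian

variable {K : Type*} [Field K] [Algebra ℂ K] {m : ℕ} [NeZero m] (c : ZMod m → K)

/-- The reflection part of the Dunkl Laplacian. -/
def reflPart (f : MvPolynomial (Fin 2) K) : MvPolynomial (Fin 2) K :=
  ∑ j : ZMod m, C (c j * zeta K m j) * divDiff j f

/-- One quarter of the Dunkl Laplacian, on invariants. -/
def lap (f : MvPolynomial (Fin 2) K) : MvPolynomial (Fin 2) K :=
  pderiv 1 (pderiv 0 f) + reflPart c (pderiv 0 f)

variable {c}

theorem reflPart_add (f g : MvPolynomial (Fin 2) K) :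
    reflPart c (f + g) = reflPart c f + reflPart c g := by
  simp only [reflPart, divDiff_add, mul_add, Finset.sum_add_distrib]

theorem reflPart_mul {f : MvPolynomial (Fin 2) K} (hf : f ∈ invariants K m)
    (g : MvPolynomial (Fin 2) K) : reflPart c (f * g) = f * reflPart c g := by
  simp only [reflPart, Finset.mul_sum]
  refine Finset.sum_congr rfl fun j _ => ?_
  rw [divDiff_mul_of_action_eq (hf _)]
  ring

theorem C_mem_invariants (a : K) : C a ∈ invariants K m := (invariants K m).algebraMap_mem a

/-- On an invariant the inner Dunkl operator is just `2 ∂_z`, so only the outer one contributes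
divided differences. -/
theorem dunkl_dunkl_eq_lap {b : MvPolynomial (Fin 2) K} (hb : b ∈ invariants K m) :
    dunkl c ![0, 2] (dunkl c ![2, 0] b) = C 4 * lap c b := by
  have h1 : dunkl c ![2, 0] b = C 2 * pderiv 0 b := by
    simp [dunkl, divDiff_eq_zero (hb _)]
  have h2 : ∀ f : MvPolynomial (Fin 2) K,
      dunkl c ![0, 2] f = C 2 * pderiv 1 f + C 2 * reflPart c f := by
    intro f
    simp only [dunkl, reflPart, Finset.mul_sum, Matrix.cons_val_zero, Matrix.cons_val_one, C_0,
      zero_mul, zero_add, sub_eq_add_neg, ← Finset.sum_neg_distrib]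
    refine congrArg _ (Finset.sum_congr rfl fun j _ => ?_)
    simp only [C_mul, C_neg]
    ring
  rw [h1, dunkl_C_mul, h2, lap]
  rw [show (4 : K) = 2 * 2 by norm_num, C_mul]
  ring

theorem lap_add (f g : MvPolynomial (Fin 2) K) : lap c (f + g) = lap c f + lap c g := by
  simp only [lap, map_add, reflPart_add]
  ring

/-- The reflection part is linear over invariants, hence acts on `∂_z (f g)` as a derivation would;
the cross term comes from the ordinary Laplacian alone. -/
theorem lap_mul {f g : MvPolynomial (Fin 2) K} (hf : f ∈ invariants K m)
    (hg : g ∈ invariants K m) : lap c (f * g) = f * lap c g + g * lap c f +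
      (pderiv 0 f * pderiv 1 g + pderiv 1 f * pderiv 0 g) := by
  have h : pderiv 0 (f * g) = f * pderiv 0 g + g * pderiv 0 f := by
    rw [pderiv_mul]
    ring
  simp only [lap, h, map_add, pderiv_mul, reflPart_add, reflPart_mul hf, reflPart_mul hg]
  ring

theorem lap_C (a : K) : lap c (C a) = 0 := by
  simp [lap, reflPart, divDiff_eq_zero (map_zero _)]

theorem lap_C_mul (a : K) {f : MvPolynomial (Fin 2) K} (hf : f ∈ invariants K m) :
    lap c (C a * f) = C a * lap c f := by
  rw [lap_mul (C_mem_invariants a) hf, lap_C]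
  simp

theorem lap_sum {ι : Type*} (s : Finset ι) (f : ι → MvPolynomial (Fin 2) K) :
    lap c (∑ i ∈ s, f i) = ∑ i ∈ s, lap c (f i) :=
  map_sum (⟨⟨lap c, by simpa using lap_C (c := c) 0⟩, lap_add⟩ :
    MvPolynomial (Fin 2) K →+ MvPolynomial (Fin 2) K) f s

theorem lap_pow_succ {f : MvPolynomial (Fin 2) K} (hf : f ∈ invariants K m) (n : ℕ) :
    lap c (f ^ (n + 1)) = (n + 1) * f ^ n * lap c f +
      (n + 1) * n * f ^ (n - 1) * (pderiv 0 f * pderiv 1 f) := by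
  induction n with
  | zero => simp
  | succ n ih =>
    rw [pow_succ f (n + 1), lap_mul (pow_mem hf _) hf, ih, pderiv_pow, pderiv_pow]
    rcases n with _ | n
    · simp
      ring
    · simp only [Nat.add_sub_cancel]
      push_cast
      ring

theorem lap_e2 : lap c (e2 K) = C (1 - ∑ j, c j) := by
  have h : ∀ j : ZMod m, divDiff j (X 1 : MvPolynomial (Fin 2) K) = -C (zeta K m (-j)) := by
    intro j
    rw [← mul_one (X 1), divDiff_X1_mul, divDiff_eq_zero (map_one _), map_one]
    ring
  have h0 : pderiv 0 (e2 K) = X 1 := by simp [e2, pderiv_X]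
  rw [lap, h0, reflPart, C_sub, map_sum, C_1, sub_eq_add_neg, ← Finset.sum_neg_distrib]
  congr 1
  · simp
  · refine Finset.sum_congr rfl fun j _ => ?_
    have := zeta_mul_zeta_neg (K := K) j
    rw [h, mul_neg, ← C_mul, mul_assoc, this, mul_one]

/-- The divided difference of `z ^ (m - 1)` is a geometric sum in `z` and `ζ ^ j z̄`; summing over
`j` turns its coefficients into Fourier coefficients of `c`. -/
theorem lap_em : lap c (em K m) = C (m : K) * ∑ i ∈ Finset.range (m - 1),
    C (∑ j, c j * zeta K m j ^ (i + 1)) * (X 0 ^ (m - 2 - i) * X 1 ^ i) := by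
  have h0 : pderiv 0 (em K m) = C (m : K) * X 0 ^ (m - 1) := by
    simp [em, pderiv_X]
  have hd : ∀ j : ZMod m, divDiff j (X 0 ^ (m - 1) : MvPolynomial (Fin 2) K) =
      ∑ i ∈ Finset.range (m - 1), X 0 ^ (m - 2 - i) * (C (zeta K m j) * X 1) ^ i := by
    intro j
    apply divDiff_eq_of_root_mul
    rw [map_pow, action_sr_X0, root, mul_comm,
      ← Commute.geom_sum₂_mul (Commute.all (X 0) (C (zeta K m j) * X 1))]
    refine congrArg (· * _) ?_
    rw [← Finset.sum_range_reflect]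
    refine Finset.sum_congr rfl fun i hi => ?_
    rw [Finset.mem_range] at hi
    congr 2
    omega
  rw [lap, h0, reflPart_mul (C_mem_invariants _), pderiv_C_mul, pderiv_pow, reflPart]
  simp only [pderiv_X, hd]
  rw [Finset.sum_congr rfl fun j _ => Finset.mul_sum _ _ _, Finset.sum_comm]
  simp only [Pi.single_apply]
  simp
  left
  refine Finset.sum_congr rfl fun i _ => ?_
  rw [Finset.sum_mul]
  refine Finset.sum_congr rfl fun j _ => ?_
  ring

end Laplacian

/-! ### Generators of the ring of invariants -/

section Homogeneous

variable {K : Type*} [Field K]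

theorem e2_isHomogeneous : (e2 K).IsHomogeneous 2 := (isHomogeneous_X _ _).mul (isHomogeneous_X _ _)

theorem em_isHomogeneous {m : ℕ} : (em K m).IsHomogeneous m :=
  (isHomogeneous_X_pow _ _).add (isHomogeneous_X_pow _ _)

/-- Newton's recurrence for the power sums of `z ^ m` and `z̄ ^ m`, whose elementary symmetric
functions are `e_m` and `e₂ ^ m`. -/
theorem add_pow_mem_adjoin (m l : ℕ) :
    (X 0 ^ (m * l) + X 1 ^ (m * l) : MvPolynomial (Fin 2) ℂ) ∈
      Algebra.adjoin ℂ {e2 ℂ, em ℂ m} := by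
  have h2 : e2 ℂ ∈ Algebra.adjoin ℂ {e2 ℂ, em ℂ m} := Algebra.subset_adjoin (by simp)
  have h3 : em ℂ m ∈ Algebra.adjoin ℂ {e2 ℂ, em ℂ m} := Algebra.subset_adjoin (by simp)
  induction l using Nat.twoStepInduction with
  | zero => simp [one_add_one_eq_two]
  | one => simpa [em] using h3
  | more l h0 h1 =>
    have : (X 0 ^ (m * (l + 2)) + X 1 ^ (m * (l + 2)) : MvPolynomial (Fin 2) ℂ) =
        em ℂ m * (X 0 ^ (m * (l + 1)) + X 1 ^ (m * (l + 1))) -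
          e2 ℂ ^ m * (X 0 ^ (m * l) + X 1 ^ (m * l)) := by
      simp only [em, e2, mul_add m, pow_add, mul_pow, mul_one, mul_two]
      ring
    rw [this]
    exact sub_mem (mul_mem h3 h1) (mul_mem (pow_mem h2 _) h0)

theorem monomial_add_swap_mem_adjoin (m a b : ℕ) (h : (a : ZMod m) - (b : ZMod m) = 0) :
    (X 0 ^ a * X 1 ^ b + X 1 ^ a * X 0 ^ b : MvPolynomial (Fin 2) ℂ) ∈
      Algebra.adjoin ℂ {e2 ℂ, em ℂ m} := by
  wlog hab : b ≤ a generalizing a b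
  · have := this b a (by rw [← neg_sub, h, neg_zero]) (by omega)
    convert this using 1
    ring
  have h2 : e2 ℂ ∈ Algebra.adjoin ℂ {e2 ℂ, em ℂ m} := Algebra.subset_adjoin (by simp)
  obtain ⟨e, rfl⟩ := Nat.exists_eq_add_of_le hab
  rw [Nat.cast_add, add_sub_cancel_left, ZMod.natCast_eq_zero_iff] at h
  obtain ⟨l, rfl⟩ := h
  have : (X 0 ^ (b + m * l) * X 1 ^ b + X 1 ^ (b + m * l) * X 0 ^ b : MvPolynomial (Fin 2) ℂ) =
      e2 ℂ ^ b * (X 0 ^ (m * l) + X 1 ^ (m * l)) := by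
    rw [e2, mul_pow]
    ring
  rw [this]
  exact mul_mem (pow_mem h2 _) (add_pow_mem_adjoin m l)

end Homogeneous

section Invariants

variable {K : Type*} [Field K] [Algebra ℂ K] {m : ℕ} [NeZero m]

theorem e2_mem_invariants : e2 K ∈ invariants K m := by
  have h : ∀ j : ZMod m, (C (zeta K m j) * C (zeta K m (-j)) : MvPolynomial (Fin 2) K) = 1 := by
    intro j
    rw [← C_mul, zeta_mul_zeta_neg, C_1]
  rintro (j | j)
  · rw [e2, map_mul, action_r_X0, action_r_X1]
    linear_combination (X 0 * X 1) * h j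
  · rw [e2, map_mul, action_sr_X0, action_sr_X1]
    linear_combination (X 0 * X 1) * h j

theorem em_mem_invariants : em K m ∈ invariants K m := by
  rintro (j | j)
  · simp only [em, map_add, map_pow, action_r_X0, action_r_X1, mul_pow, ← C_pow, zeta_pow_card,
      C_1, one_mul]
  · simp only [em, map_add, map_pow, action_sr_X0, action_sr_X1, mul_pow, ← C_pow, zeta_pow_card,
      C_1, one_mul]
    ring

/-- The sum of the translates of a monomial under the dihedral group. -/
theorem sum_action_monomial (a b : ℕ) :
    ∑ g : DihedralGroup m, action ℂ m g (X 0 ^ a * X 1 ^ b) =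
      C (∑ j : ZMod m, ZMod.stdAddChar (j * ((a : ZMod m) - (b : ZMod m)))) *
        (X 0 ^ a * X 1 ^ b + X 1 ^ a * X 0 ^ b) := by
  have hz : ∀ j : ZMod m, zeta ℂ m j ^ a * zeta ℂ m (-j) ^ b =
      ZMod.stdAddChar (j * ((a : ZMod m) - (b : ZMod m))) := by
    intro j
    rw [← zeta_natCast_mul, ← zeta_natCast_mul, ← zeta_add, zeta]
    simp only [Algebra.algebraMap_self, RingHom.id_apply]
    congr 1
    ring
  have e : ∑ g : DihedralGroup m, action ℂ m g (X 0 ^ a * X 1 ^ b) =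
      ∑ j : ZMod m, action ℂ m (.r j) (X 0 ^ a * X 1 ^ b) +
      ∑ j : ZMod m, action ℂ m (.sr j) (X 0 ^ a * X 1 ^ b) := by
    let φ : ZMod m ⊕ ZMod m ≃ DihedralGroup m :=
      { toFun := fun i => i.rec (fun j => .r j) (fun j => .sr j)
        invFun := fun i => match i with
          | .r j => Sum.inl j
          | .sr j => Sum.inr j
        left_inv := by rintro (x | x) <;> rfl
        right_inv := by rintro (x | x) <;> rfl }
    rw [← φ.sum_comp, Fintype.sum_sum_type]
    rfl
  rw [e, ← Finset.sum_add_distrib, map_sum, Finset.sum_mul]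
  refine Finset.sum_congr rfl fun j _ => ?_
  simp only [map_mul, map_pow, action_r_X0, action_r_X1, action_sr_X0, action_sr_X1, ← hz j]
  ring

/-- The algebra of invariants is generated by `e₂` and `e_m`. -/
theorem adjoin_e2_em : Algebra.adjoin ℂ {e2 ℂ, em ℂ m} = invariants ℂ m := by
  apply le_antisymm
  · rw [Algebra.adjoin_le_iff]
    rintro f (rfl | rfl)
    exacts [e2_mem_invariants, em_mem_invariants]
  · intro f hf
    have h0 : (Fintype.card (DihedralGroup m) : ℂ) ≠ 0 := by
      exact_mod_cast Fintype.card_ne_zero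
    -- An invariant is its own average over the group, so it suffices to treat averages of
    -- monomials.
    have h1 : f = C (Fintype.card (DihedralGroup m) : ℂ)⁻¹ *
        ∑ g : DihedralGroup m, action ℂ m g f := by
      rw [Finset.sum_congr rfl fun g _ => hf g, Finset.sum_const, Finset.card_univ, nsmul_eq_mul,
        ← mul_assoc, ← map_natCast C, ← C_mul, inv_mul_cancel₀ h0, C_1, one_mul]
    rw [h1]
    refine mul_mem ((Algebra.adjoin ℂ {e2 ℂ, em ℂ m}).algebraMap_mem _) ?_
    clear h1 hf
    induction f using MvPolynomial.induction_on' with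
    | add p q hp hq =>
      simp only [map_add, Finset.sum_add_distrib]
      exact add_mem hp hq
    | monomial d a =>
      have hd : monomial d a = C a * (X 0 ^ d 0 * X 1 ^ d 1) := by
        rw [monomial_eq, Finsupp.prod_fintype _ _ (by simp), Fin.prod_univ_two]
      simp only [hd, map_mul (action ℂ m _) (C a), action_C, ← Finset.mul_sum]
      refine mul_mem ((Algebra.adjoin ℂ {e2 ℂ, em ℂ m}).algebraMap_mem _) ?_
      -- The character sum vanishes unless the two exponents are congruent modulo `m`; then the
      -- symmetrized monomial is a power of `e₂` times a power sum.
      rw [sum_action_monomial, AddChar.sum_mulShift _ (ZMod.isPrimitive_stdAddChar m)]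
      split_ifs with h
      · exact mul_mem ((Algebra.adjoin ℂ {e2 ℂ, em ℂ m}).algebraMap_mem _)
          (monomial_add_swap_mem_adjoin _ _ _ h)
      · simp

theorem isGenerators_e2_em : IsGenerators m (e2 ℂ) (em ℂ m) :=
  ⟨e2_isHomogeneous, em_isHomogeneous, adjoin_e2_em⟩

end Invariants

/-! ### Homogeneous elements of spans, and the possible generating sets -/

section Span

variable {F : Type*} [Field F] {σ : Type*}

/-- A homogeneous element of the span of homogeneous polynomials `f i` of degrees `w i` lies in the
span of those of the same degree. -/
theorem mem_span_of_isHomogeneous {ι : Type*} {f : ι → MvPolynomial σ F} {w : ι → ℕ}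
    (hf : ∀ i, (f i).IsHomogeneous (w i)) {s : Set ι} {p : MvPolynomial σ F} {n : ℕ}
    (hp : p.IsHomogeneous n) (hps : p ∈ Submodule.span F (f '' s)) :
    p ∈ Submodule.span F (f '' {i ∈ s | w i = n}) := by
  rw [← homogeneousComponent_eq_self hp]
  have h := Submodule.mem_map_of_mem (f := homogeneousComponent n) hps
  rw [Submodule.map_span] at h
  refine Submodule.span_le.2 ?_ h
  rintro _ ⟨_, ⟨i, hi, rfl⟩, rfl⟩
  rw [homogeneousComponent_of_mem ((mem_homogeneousSubmodule _ _).2 (hf i))]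
  split_ifs with hn
  · exact Submodule.subset_span ⟨i, ⟨hi, hn.symm⟩, rfl⟩
  · exact zero_mem _

theorem adjoin_pair_eq_span {A : Type*} [CommRing A] [Algebra F A] (u v : A) :
    Subalgebra.toSubmodule (Algebra.adjoin F {u, v}) =
      Submodule.span F ((fun a : ℕ × ℕ => u ^ a.1 * v ^ a.2) '' Set.univ) := by
  rw [Algebra.adjoin_eq_span]
  congr 1
  ext x
  simp only [SetLike.mem_coe, Submonoid.mem_closure_pair, Set.image_univ, Set.mem_range,
    Prod.exists]

end Span

section Generators

variable {m : ℕ} [NeZero m]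

theorem zeta_one_pow_ne_one {n : ℕ} (h0 : 0 < n) (h : n < m) : zeta ℂ m 1 ^ n ≠ 1 := by
  rw [← zeta_natCast_mul, ← zeta_zero ℂ m, zeta, zeta]
  simp only [Algebra.algebraMap_self, RingHom.id_apply, mul_one]
  intro hn
  have := ZMod.injective_stdAddChar hn
  rw [ZMod.natCast_eq_zero_iff] at this
  exact absurd (Nat.le_of_dvd h0 this) (by omega)

theorem eval_smul_of_isHomogeneous {f : MvPolynomial (Fin 2) ℂ} {n : ℕ} (hf : f.IsHomogeneous n)
    (a : ℂ) (v : Fin 2 → ℂ) : eval (a • v) f = a ^ n * eval v f := by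
  rw [eval_eq, eval_eq, Finset.mul_sum]
  refine Finset.sum_congr rfl fun d hd => ?_
  simp only [Pi.smul_apply, smul_eq_mul, mul_pow, Finset.prod_mul_distrib,
    Finset.prod_pow_eq_pow_sum]
  rw [hf.degree_eq_sum_deg_support hd]
  ring

theorem IsGenerators.exists_eq (hm : 3 ≤ m) {u₁ u₂ : MvPolynomial (Fin 2) ℂ}
    (h : IsGenerators m u₁ u₂) : ∃ r s t : ℂ, r ≠ 0 ∧ s ≠ 0 ∧ u₁ = C r * e2 ℂ ∧
      u₂ = C s * em ℂ m + C t * e2 ℂ ^ (m / 2) := by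
  obtain ⟨h1, h2, h3⟩ := h
  have hhom : ∀ a : ℕ × ℕ, (e2 ℂ ^ a.1 * em ℂ m ^ a.2).IsHomogeneous (2 * a.1 + m * a.2) :=
    fun a => (e2_isHomogeneous.pow _).mul (em_isHomogeneous.pow _)
  have hspan : ∀ u ∈ ({u₁, u₂} : Set (MvPolynomial (Fin 2) ℂ)), ∀ n, u.IsHomogeneous n →
      u ∈ Submodule.span ℂ ((fun a : ℕ × ℕ => e2 ℂ ^ a.1 * em ℂ m ^ a.2) ''
        {a ∈ Set.univ | 2 * a.1 + m * a.2 = n}) := by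
    intro u hu n hn
    refine mem_span_of_isHomogeneous hhom hn ?_
    rw [← adjoin_pair_eq_span, adjoin_e2_em, ← h3]
    exact Algebra.subset_adjoin hu
  have e1 : ∃ r : ℂ, u₁ = C r * e2 ℂ := by
    have := hspan u₁ (by simp) 2 h1
    have hs : {a : ℕ × ℕ | a ∈ Set.univ ∧ 2 * a.1 + m * a.2 = 2} = {(1, 0)} := by
      ext ⟨i, l⟩
      simp only [Set.mem_univ, true_and, Set.mem_ofPred_eq, Set.mem_singleton_iff, Prod.mk.injEq]
      constructor
      · intro h
        rcases l with _ | l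
        · omega
        · nlinarith
      · rintro ⟨rfl, rfl⟩
        rfl
    rw [hs, Set.image_singleton, Submodule.mem_span_singleton] at this
    obtain ⟨r, hr⟩ := this
    exact ⟨r, by rw [← hr, smul_eq_C_mul]; simp⟩
  have e2' : ∃ s t : ℂ, u₂ = C s * em ℂ m + C t * e2 ℂ ^ (m / 2) := by
    have := hspan u₂ (by simp) m h2
    -- Only an inclusion: for odd `m` the exponent `(m / 2, 0)` does not have degree `m`, but
    -- allowing it treats both parities at once.
    have hs : {a : ℕ × ℕ | a ∈ Set.univ ∧ 2 * a.1 + m * a.2 = m} ⊆ {(0, 1), (m / 2, 0)} := by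
      rintro ⟨i, l⟩ ⟨-, h⟩
      simp only [Set.mem_insert_iff, Set.mem_singleton_iff, Prod.mk.injEq]
      simp only at h
      rcases l with _ | _ | l
      · right
        omega
      · left
        omega
      · nlinarith
    have := Submodule.span_mono (Set.image_mono hs) this
    rw [Set.image_pair, Submodule.mem_span_pair] at this
    obtain ⟨s, t, hst⟩ := this
    exact ⟨s, t, by rw [← hst, smul_eq_C_mul, smul_eq_C_mul]; simp⟩
  obtain ⟨r, hr⟩ := e1
  obtain ⟨s, t, hst⟩ := e2'
  -- Points not separated by the generators are not separated by any invariant. This excludes `r =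
  -- 0` and `s = 0`.
  have hle : ∀ v w : Fin 2 → ℂ, eval v u₁ = eval w u₁ → eval v u₂ = eval w u₂ →
      ∀ f ∈ invariants ℂ m, eval v f = eval w f := by
    intro v w hv hw f hf
    rw [← h3] at hf
    have : Algebra.adjoin ℂ {u₁, u₂} ≤
        AlgHom.equalizer (MvPolynomial.aeval v : MvPolynomial (Fin 2) ℂ →ₐ[ℂ] ℂ)
          (MvPolynomial.aeval w) := by
      rw [Algebra.adjoin_le_iff]
      rintro g (rfl | rfl)
      · simpa [AlgHom.mem_equalizer, coe_aeval_eq_eval] using hv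
      · simpa [AlgHom.mem_equalizer, coe_aeval_eq_eval] using hw
    simpa [AlgHom.mem_equalizer, coe_aeval_eq_eval] using this hf
  refine ⟨r, s, t, ?_, ?_, hr, hst⟩
  · rintro rfl
    -- If `u₁ = 0`, then scaling by `ζ` is invisible to `u₂`, of degree `m`, but not to `e₂`, since
    -- `ζ ^ 2 ≠ 1` for `m ≥ 3`.
    have := hle (zeta ℂ m 1 • ![1, 1]) ![1, 1] (by simp [hr])
      (by rw [eval_smul_of_isHomogeneous h2, zeta_pow_card, one_mul]) _ e2_mem_invariants
    rw [eval_smul_of_isHomogeneous e2_isHomogeneous] at this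
    simp only [e2, map_mul, eval_X, Matrix.cons_val_zero, Matrix.cons_val_one, mul_one] at this
    exact zeta_one_pow_ne_one (m := m) two_pos (by omega) this
  · rintro rfl
    have h0 : m / 2 ≠ 0 := by omega
    -- If `s = 0`, both generators vanish wherever `e₂` does, so they cannot separate `(1, 0)` from
    -- the origin, whereas `e_m` does.
    have := hle ![1, 0] ![0, 0] (by simp [hr, e2]) (by simp [hst, e2, h0]) _ em_mem_invariants
    simp [em, NeZero.ne m] at this

end Generators

/-! ### Positivity of the form at `c = 0` -/

section ParameterZero

variable {m : ℕ} [NeZero m]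

theorem coeff_iterate_pderiv (i : Fin 2) (b : ℕ) {e : Fin 2 →₀ ℕ} (he : e i = 0)
    (f : MvPolynomial (Fin 2) ℂ) :
    coeff e ((fun f => C 2 * pderiv i f)^[b] f) =
      2 ^ b * b.factorial * coeff (e + Finsupp.single i b) f := by
  induction b generalizing f with
  | zero => simp
  | succ b ih =>
    rw [Function.iterate_succ_apply, ih, coeff_C_mul, coeff_pderiv, add_assoc,
      ← Finsupp.single_add]
    simp only [Finsupp.add_apply, he, Finsupp.single_eq_same, zero_add, Nat.factorial_succ]
    push_cast
    ring

/-- At `c = 0` the operators are `2 ∂_z̄` for `z` and `2 ∂_z` for `z̄`, so a monomial picks out the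
coefficient with interchanged exponents. -/
theorem form_zero_monomial (d : Fin 2 →₀ ℕ) (a : ℂ) (f : MvPolynomial (Fin 2) ℂ) :
    form (0 : ZMod m → ℂ) (monomial d a) f =
      a * (2 ^ d 0 * (d 0).factorial * (2 ^ d 1 * (d 1).factorial)) *
        coeff (Finsupp.single 1 (d 0) + Finsupp.single 0 (d 1)) f := by
  have h0 : dunkl (0 : ZMod m → ℂ) ![0, 2] = fun f => C 2 * pderiv 1 f := by
    ext1 f
    simp [dunkl]
  have h1 : dunkl (0 : ZMod m → ℂ) ![2, 0] = fun f => C 2 * pderiv 0 f := by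
    ext1 f
    simp [dunkl]
  rw [form_monomial, h0, h1, coeff_iterate_pderiv _ _ rfl, zero_add,
    coeff_iterate_pderiv _ _ (by simp)]
  ring

theorem coeff_swap_of_mem_invariants {f : MvPolynomial (Fin 2) ℂ} (hf : f ∈ invariants ℂ m)
    (d : Fin 2 →₀ ℕ) :
    coeff (Finsupp.single 1 (d 0) + Finsupp.single 0 (d 1)) f = coeff d f := by
  have h : action ℂ m (.sr 0) = rename (Equiv.swap (0 : Fin 2) 1) := by
    apply MvPolynomial.algHom_ext
    intro i
    fin_cases i
    · simp [action_sr_X0, zeta_zero]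
    · simp [action_sr_X1, zeta_zero]
  have hd : Finsupp.single 1 (d 0) + Finsupp.single 0 (d 1) =
      Finsupp.mapDomain (Equiv.swap (0 : Fin 2) 1) d := by
    conv_rhs => rw [← Finsupp.univ_sum_single d]
    rw [Fin.sum_univ_two, Finsupp.mapDomain_add, Finsupp.mapDomain_single,
      Finsupp.mapDomain_single]
    simp
  rw [hd]
  conv_lhs => rw [← hf (.sr 0), h]
  rw [coeff_rename_mapDomain _ (Equiv.injective _)]

/-- At `c = 0` the form is positive definite on invariants. -/
theorem eq_zero_of_form_zero_conj {f : MvPolynomial (Fin 2) ℂ} (hf : f ∈ invariants ℂ m)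
    (h : form (0 : ZMod m → ℂ) (map (starRingEnd ℂ) f) f = 0) : f = 0 := by
  by_contra hne
  -- Invariance under `s_0`, which interchanges `z` and `z̄`, undoes the exchange of exponents; what
  -- remains is a sum of squared absolute values with positive weights.
  have e : form (0 : ZMod m → ℂ) (map (starRingEnd ℂ) f) f =
      ((∑ d ∈ f.support, Complex.normSq (coeff d f) *
        (2 ^ d 0 * (d 0).factorial * (2 ^ d 1 * (d 1).factorial)) : ℝ) : ℂ) := by
    have h1 : map (starRingEnd ℂ) f =
        ∑ d ∈ f.support, monomial d (starRingEnd ℂ (coeff d f)) := by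
      conv_lhs => rw [f.as_sum]
      simp only [map_sum, map_monomial]
    rw [h1, form_eq_formLin, map_sum, LinearMap.sum_apply]
    push_cast
    refine Finset.sum_congr rfl fun d _ => ?_
    rw [← form_eq_formLin, form_zero_monomial, coeff_swap_of_mem_invariants hf,
      ← Complex.mul_conj]
    ring
  rw [e, Complex.ofReal_eq_zero] at h
  have hpos : 0 < ∑ d ∈ f.support, Complex.normSq (coeff d f) *
      (2 ^ d 0 * (d 0).factorial * (2 ^ d 1 * (d 1).factorial) : ℝ) := by
    refine Finset.sum_pos (fun d hd => ?_) (support_nonempty.2 hne)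
    have := Complex.normSq_pos.2 (mem_support_iff.1 hd)
    positivity
  exact hpos.ne' h

end ParameterZero

/-! ### Nondegeneracy by specialization to `c = 0` -/

section Specialization

variable {K : Type*} [Field K] [Algebra ℂ K] {m : ℕ} [NeZero m]

theorem algebraMap_zeta (j : ZMod m) : algebraMap ℂ K (zeta ℂ m j) = zeta K m j := rfl

theorem action_map (g : DihedralGroup m) (f : MvPolynomial (Fin 2) ℂ) :
    action K m g (map (algebraMap ℂ K) f) = map (algebraMap ℂ K) (action ℂ m g f) := by
  induction f using MvPolynomial.induction_on with
  | C a => rw [map_C, action_C, action_C, map_C]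
  | add p q hp hq => simp only [map_add, hp, hq]
  | mul_X p i hp =>
    rw [map_mul, map_mul, map_mul, map_mul, hp, map_X]
    congr 1
    rcases g with j | j <;> fin_cases i
    all_goals simp [action_r_X0, action_r_X1, action_sr_X0, action_sr_X1, algebraMap_zeta]

theorem divDiff_map (j : ZMod m) (f : MvPolynomial (Fin 2) ℂ) :
    divDiff j (map (algebraMap ℂ K) f) = map (algebraMap ℂ K) (divDiff j f) := by
  apply divDiff_eq_of_root_mul
  have h : root K m j = map (algebraMap ℂ K) (root ℂ m j) := by
    simp [root, algebraMap_zeta]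
  rw [h, ← map_mul, root_mul_divDiff, action_map, map_sub]

variable {A : Type*} [CommRing A] [Algebra ℂ A] [Algebra A K] [IsScalarTower ℂ A K]

/-- No denominators in the parameters arise: the divided difference of a monomial has complex
coefficients, and the coefficient in `A` factors out. -/
theorem exists_divDiff_map_eq (j : ZMod m) (p : MvPolynomial (Fin 2) A) :
    ∃ q : MvPolynomial (Fin 2) A,
      divDiff j (map (algebraMap A K) p) = map (algebraMap A K) q := by
  induction p using MvPolynomial.induction_on' with
  | add p q hp hq =>
    obtain ⟨p', hp⟩ := hp
    obtain ⟨q', hq⟩ := hq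
    exact ⟨p' + q', by rw [map_add, divDiff_add, hp, hq, map_add]⟩
  | monomial d a =>
    refine ⟨C a * map (algebraMap ℂ A) (divDiff j (monomial d 1)), ?_⟩
    have h : monomial d a = C a * map (algebraMap ℂ A) (monomial d 1) := by
      rw [map_monomial, map_one, C_mul_monomial, mul_one]
    rw [h, map_mul, map_mul, map_C, divDiff_C_mul, map_map, map_map,
      ← IsScalarTower.algebraMap_eq, divDiff_map]

variable (ε : A →ₐ[ℂ] ℂ) {cA : ZMod m → A} {c : ZMod m → K}

theorem exists_dunkl_map_eq (hε : ∀ j, ε (cA j) = 0) (hc : ∀ j, c j = algebraMap A K (cA j))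
    (y : Fin 2 → ℂ) (p : MvPolynomial (Fin 2) A) :
    ∃ q : MvPolynomial (Fin 2) A,
      dunkl c (algebraMap ℂ K ∘ y) (map (algebraMap A K) p) = map (algebraMap A K) q ∧
      dunkl (0 : ZMod m → ℂ) y (map (ε : A →+* ℂ) p) = map (ε : A →+* ℂ) q := by
  choose q hq using fun j : ZMod m => exists_divDiff_map_eq (K := K) j p
  have hA : ∀ x : ℂ, algebraMap A K (algebraMap ℂ A x) = algebraMap ℂ K x :=
    fun x => (IsScalarTower.algebraMap_apply ℂ A K x).symm
  refine ⟨C (algebraMap ℂ A (y 0)) * pderiv 0 p + C (algebraMap ℂ A (y 1)) * pderiv 1 p -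
    ∑ j : ZMod m, C (cA j * algebraMap ℂ A (y 0 - zeta ℂ m j * y 1)) * q j, ?_, ?_⟩
  · simp only [dunkl, map_sub, map_add, map_mul, map_sum, map_C, pderiv_map, hq, hc, hA,
      Function.comp_apply, algebraMap_zeta]
  · simp [dunkl, pderiv_map, hε]

theorem exists_iterate_dunkl_map_eq (hε : ∀ j, ε (cA j) = 0)
    (hc : ∀ j, c j = algebraMap A K (cA j)) (y : Fin 2 → ℂ) (n : ℕ) (p : MvPolynomial (Fin 2) A) :
    ∃ q : MvPolynomial (Fin 2) A,
      (dunkl c (algebraMap ℂ K ∘ y))^[n] (map (algebraMap A K) p) = map (algebraMap A K) q ∧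
      (dunkl (0 : ZMod m → ℂ) y)^[n] (map (ε : A →+* ℂ) p) = map (ε : A →+* ℂ) q := by
  induction n generalizing p with
  | zero => exact ⟨p, rfl, rfl⟩
  | succ n ih =>
    obtain ⟨q, h1, h2⟩ := exists_dunkl_map_eq ε hε hc y p
    rw [Function.iterate_succ_apply, Function.iterate_succ_apply, h1, h2]
    exact ih q

/-- The form on polynomials with complex coefficients takes values in the ring of parameters, and
specializes to the form at `c = 0`. -/
theorem exists_form_map_eq (hε : ∀ j, ε (cA j) = 0) (hc : ∀ j, c j = algebraMap A K (cA j))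
    (f g : MvPolynomial (Fin 2) ℂ) : ∃ a : A,
      form c (map (algebraMap ℂ K) f) (map (algebraMap ℂ K) g) = algebraMap A K a ∧
      form (0 : ZMod m → ℂ) f g = ε a := by
  induction f using MvPolynomial.induction_on' with
  | add p q hp hq =>
    obtain ⟨p', hp, hp'⟩ := hp
    obtain ⟨q', hq, hq'⟩ := hq
    refine ⟨p' + q', ?_, ?_⟩
    · rw [form_eq_formLin] at *
      rw [map_add (map _), map_add (formLin c), LinearMap.add_apply, hp, hq, map_add]
    · rw [form_eq_formLin] at *
      rw [map_add (formLin _), LinearMap.add_apply, hp', hq', map_add]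
  | monomial d x =>
    obtain ⟨q, h1, h1'⟩ := exists_iterate_dunkl_map_eq (K := K) ε hε hc ![2, 0] (d 1)
      (map (algebraMap ℂ A) g)
    obtain ⟨q', h2, h2'⟩ := exists_iterate_dunkl_map_eq (K := K) ε hε hc ![0, 2] (d 0) q
    have e1 : algebraMap ℂ K ∘ ![2, 0] = ![2, 0] := by
      ext i
      fin_cases i <;> simp [map_ofNat]
    have e2 : algebraMap ℂ K ∘ ![0, 2] = ![0, 2] := by
      ext i
      fin_cases i <;> simp [map_ofNat]
    rw [map_map, ← IsScalarTower.algebraMap_eq, e1] at h1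
    have e3 : map (ε : A →+* ℂ) (map (algebraMap ℂ A) g) = g := by
      rw [map_map, AlgHom.comp_algebraMap, Algebra.algebraMap_self, map_id]
    rw [e3] at h1'
    rw [e2] at h2
    refine ⟨algebraMap ℂ A x * coeff 0 q', ?_, ?_⟩
    · rw [map_monomial, form_monomial, h1, h2, coeff_map, map_mul,
        ← IsScalarTower.algebraMap_apply]
    · rw [form_monomial, h1', h2', coeff_map, map_mul, AlgHom.commutes]
      rfl

/-- Nondegeneracy of the form, by specialization to `c = 0`. -/
theorem eq_zero_of_forall_form_eq_zero [IsDomain A] [FaithfulSMul A K] (hε : ∀ j, ε (cA j) = 0)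
    (hc : ∀ j, c j = algebraMap A K (cA j)) (S : Submodule ℂ (MvPolynomial (Fin 2) ℂ))
    [FiniteDimensional ℂ S] (hinv : ∀ f ∈ S, f ∈ invariants ℂ m)
    (hconj : ∀ f ∈ S, map (starRingEnd ℂ) f ∈ S) {w : MvPolynomial (Fin 2) K}
    (hw : w ∈ Submodule.span K (map (algebraMap ℂ K) '' (S : Set (MvPolynomial (Fin 2) ℂ))))
    (h : ∀ f ∈ S, form c (map (algebraMap ℂ K) f) w = 0) : w = 0 := by
  let β := Module.finBasis ℂ S
  have hw' : w ∈ Submodule.span K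
      (Set.range fun i => map (algebraMap ℂ K) (β i : MvPolynomial (Fin 2) ℂ)) := by
    refine Submodule.span_le.2 ?_ hw
    rintro _ ⟨f, hf, rfl⟩
    have hsum := congrArg Subtype.val (β.sum_repr ⟨f, hf⟩)
    rw [Submodule.coe_sum] at hsum
    simp only at hsum
    rw [← hsum, map_sum]
    refine sum_mem fun i _ => ?_
    rw [Submodule.coe_smul, smul_eq_C_mul, map_mul, map_C, ← smul_eq_C_mul]
    exact Submodule.smul_mem _ _ (Submodule.subset_span ⟨i, rfl⟩)
  obtain ⟨γ, hγ⟩ := (Submodule.mem_span_range_iff_exists_fun K).1 hw'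
  choose G hG hG' using fun i j => exists_form_map_eq (K := K) ε hε hc
    (β i : MvPolynomial (Fin 2) ℂ) (β j : MvPolynomial (Fin 2) ℂ)
  have hmul : ((Matrix.of G).map (algebraMap A K)).mulVec γ = 0 := by
    ext i
    have hi := h _ (β i).2
    rw [← hγ, form_eq_formLin, map_sum] at hi
    simp only [Matrix.mulVec, dotProduct, Matrix.map_apply, Matrix.of_apply, Pi.zero_apply, ← hG]
    rw [← hi]
    refine Finset.sum_congr rfl fun j _ => ?_
    rw [map_smul, smul_eq_mul, mul_comm, form_eq_formLin]
  -- A nonzero `γ` makes the Gram determinant vanish in `K`, hence in `A`, hence after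
  -- specialization. The specialized Gram matrix then has a kernel vector, which yields an element
  -- of `S` orthogonal to its own conjugate at `c = 0`, contrary to positivity.
  by_cases hγ0 : γ = 0
  · rw [← hγ, hγ0]
    simp
  exfalso
  have hdet : (Matrix.of G).det = 0 := by
    have := Matrix.exists_mulVec_eq_zero_iff.1 ⟨γ, hγ0, hmul⟩
    rw [← RingHom.mapMatrix_apply, ← RingHom.map_det] at this
    exact (map_eq_zero_iff _ (FaithfulSMul.algebraMap_injective A K)).1 this
  have hdet' : ((ε : A →+* ℂ).mapMatrix (Matrix.of G)).det = 0 := by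
    rw [← RingHom.map_det, hdet, map_zero]
  obtain ⟨v, hv0, hv⟩ := Matrix.exists_mulVec_eq_zero_iff.2 hdet'
  set f : S := ∑ i, v i • β i with hf
  have horth : ∀ g ∈ S, form (0 : ZMod m → ℂ) g f = 0 := by
    have hb : ∀ i, form (0 : ZMod m → ℂ) (β i : MvPolynomial (Fin 2) ℂ) f = 0 := by
      intro i
      have hi := congrFun hv i
      simp only [Matrix.mulVec, dotProduct, RingHom.mapMatrix_apply, Matrix.map_apply,
        Matrix.of_apply, Pi.zero_apply, RingHom.coe_coe, ← hG'] at hi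
      rw [hf, form_eq_formLin, Submodule.coe_sum, map_sum, ← hi]
      refine Finset.sum_congr rfl fun j _ => ?_
      rw [Submodule.coe_smul, map_smul, smul_eq_mul, mul_comm, form_eq_formLin]
    intro g hg
    have hsum := congrArg Subtype.val (β.sum_repr ⟨g, hg⟩)
    rw [Submodule.coe_sum] at hsum
    simp only at hsum
    rw [← hsum, form_eq_formLin, map_sum, LinearMap.sum_apply]
    refine Finset.sum_eq_zero fun i _ => ?_
    rw [Submodule.coe_smul, map_smul, LinearMap.smul_apply, ← form_eq_formLin, hb, smul_zero]
  have hf0 : f = 0 :=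
    Subtype.ext (eq_zero_of_form_zero_conj (hinv _ f.2) (horth _ (hconj _ f.2)))
  have := Fintype.linearIndependent_iff.1 β.linearIndependent v (hf ▸ hf0)
  exact hv0 (funext this)

end Specialization

/-! ### Triangularity with respect to the leading power -/

section LowerSpan

variable {K : Type*} [Field K] {B : Type*} [CommRing B] [Algebra K B]

/-- The span of the monomials `u ^ i v ^ l` with `l < k`. -/
def lowerSpan (K : Type*) [Field K] {B : Type*} [CommRing B] [Algebra K B] (u v : B) (k : ℕ) :
    Submodule K B :=
  Submodule.span K ((fun a : ℕ × ℕ => u ^ a.1 * v ^ a.2) '' {a | a.2 < k})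

theorem monomial_mem_lowerSpan (u v : B) (i : ℕ) {l k : ℕ} (h : l < k) :
    u ^ i * v ^ l ∈ lowerSpan K u v k :=
  Submodule.subset_span ⟨(i, l), h, rfl⟩

theorem lowerSpan_mono (u v : B) {k l : ℕ} (h : k ≤ l) :
    lowerSpan K u v k ≤ lowerSpan K u v l :=
  Submodule.span_mono (Set.image_mono fun _ ha => lt_of_lt_of_le ha h)

theorem mul_mem_lowerSpan {u v : B} {k : ℕ} {x : B} (hx : x ∈ lowerSpan K u v k) (i l : ℕ) :
    u ^ i * v ^ l * x ∈ lowerSpan K u v (k + l) := by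
  induction hx using Submodule.span_induction with
  | mem x hx =>
    obtain ⟨a, ha, rfl⟩ := hx
    rw [Set.mem_ofPred_eq] at ha
    convert monomial_mem_lowerSpan (K := K) u v (i + a.1) (l := l + a.2) (k := k + l)
      (by omega) using 1
    ring
  | zero => rw [mul_zero]; exact zero_mem _
  | add x y _ _ hx hy => rw [mul_add]; exact add_mem hx hy
  | smul a x _ hx => rw [mul_smul_comm]; exact Submodule.smul_mem _ _ hx

theorem pow_sub_smul_pow_mem_lowerSpan {u v v' : B} {s t : K} {n : ℕ}
    (h : v' = s • v + t • u ^ n) (k : ℕ) : v' ^ k - s ^ k • v ^ k ∈ lowerSpan K u v k := by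
  induction k with
  | zero => simp
  | succ k ih =>
    have h1 := mul_mem_lowerSpan ih 0 1
    have h2 := mul_mem_lowerSpan ih n 0
    have h3 := monomial_mem_lowerSpan (K := K) u v n (Nat.lt_succ_self k)
    have e : v' ^ (k + 1) - s ^ (k + 1) • v ^ (k + 1) =
        s • (u ^ 0 * v ^ 1 * (v' ^ k - s ^ k • v ^ k)) +
        t • (u ^ n * v ^ 0 * (v' ^ k - s ^ k • v ^ k)) + (t * s ^ k) • (u ^ n * v ^ k) := by
      rw [pow_succ v' k]
      nth_rewrite 2 [h]
      simp only [Algebra.smul_def, map_mul, map_pow]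
      ring
    rw [e]
    exact add_mem (add_mem (Submodule.smul_mem _ _ h1) (Submodule.smul_mem _ _
      (lowerSpan_mono u v (Nat.le_succ k) h2))) (Submodule.smul_mem _ _ h3)

/-- The filtration by the exponent of the second generator is preserved by triangular substitutions;
this makes canonicity independent of the generators. -/
theorem lowerSpan_le {u u' v v' : B} {r s t : K} {n : ℕ} (hu : u' = r • u)
    (h : v' = s • v + t • u ^ n) (k : ℕ) : lowerSpan K u' v' k ≤ lowerSpan K u v k := by
  refine Submodule.span_le.2 ?_
  rintro _ ⟨⟨i, l⟩, hl, rfl⟩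
  rw [Set.mem_ofPred_eq] at hl
  have h1 : v' ^ l ∈ lowerSpan K u v k := by
    rw [← sub_add_cancel (v' ^ l) (s ^ l • v ^ l)]
    refine add_mem (lowerSpan_mono u v hl.le (pow_sub_smul_pow_mem_lowerSpan h l))
      (Submodule.smul_mem _ _ ?_)
    simpa using monomial_mem_lowerSpan (K := K) u v 0 hl
  have h2 := Submodule.smul_mem _ (r ^ i) (mul_mem_lowerSpan h1 i 0)
  have e : u' ^ i * v' ^ l = r ^ i • (u ^ i * v ^ 0 * v' ^ l) := by
    rw [hu, smul_pow, smul_mul_assoc, pow_zero, mul_one]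
  simp only [SetLike.mem_coe, e]
  exact h2

end LowerSpan

/-! ### Harmonic invariants are the canonical ones -/

section Canonical

variable {K : Type*} [Field K] [Algebra ℂ K] {m : ℕ} [NeZero m]

theorem span_monom_eq_lowerSpan (u₁ u₂ : MvPolynomial (Fin 2) ℂ) (k : ℕ) :
    Submodule.span K {p | ∃ a', Prec a' (0, k) ∧ p = monom K u₁ u₂ a'} =
      lowerSpan K (map (algebraMap ℂ K) u₁) (map (algebraMap ℂ K) u₂) k := by
  rw [lowerSpan]
  congr 1
  ext p
  constructor
  · rintro ⟨a, ha, rfl⟩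
    refine ⟨a, ?_, by simp [monom]⟩
    simpa [Prec] using ha
  · rintro ⟨a, ha, rfl⟩
    exact ⟨a, by simpa [Prec] using ha, by simp [monom]⟩

theorem map_e2 {F G : Type*} [Field F] [Field G] (f : F →+* G) : map f (e2 F) = e2 G := by
  simp [e2]

theorem map_em {F G : Type*} [Field F] [Field G] (f : F →+* G) (m : ℕ) :
    map f (em F m) = em G m := by
  simp [em]

theorem complex_smul_eq (r : ℂ) (p : MvPolynomial (Fin 2) K) :
    r • p = C (algebraMap ℂ K r) * p := by
  rw [← smul_eq_C_mul, algebraMap_smul]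

theorem monom_e2_em (m : ℕ) (a : ℕ × ℕ) :
    monom K (e2 ℂ) (em ℂ m) a = e2 K ^ a.1 * em K m ^ a.2 := by
  rw [monom, map_mul, map_pow, map_pow, map_e2, map_em]

theorem isCanonical_of_lap_eq_zero (hm : 3 ≤ m) {c : ZMod m → K}
    (hc : ∀ i j, c (2 * j - i) = c i) {k : ℕ} {b : MvPolynomial (Fin 2) K}
    (hinv : b ∈ invariants K m) (hhom : b.IsHomogeneous (m * k)) (hlap : lap c b = 0)
    {r : ℂ} (hr : r ≠ 0) (hb : b - r • em K m ^ k ∈ lowerSpan K (e2 K) (em K m) k) :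
    IsCanonical c (0, k) b := by
  have hharm : dunkl c ![0, 2] (dunkl c ![2, 0] b) = 0 := by
    rw [dunkl_dunkl_eq_lap hinv, hlap, mul_zero]
  refine ⟨⟨_, hhom⟩, hinv, fun u₁ u₂ hu => ⟨?_, ?_⟩⟩
  · obtain ⟨x, s, t, hx, hs, h1, h2⟩ := hu.exists_eq hm
    rw [span_monom_eq_lowerSpan]
    have hx' : algebraMap ℂ K x ≠ 0 := (map_ne_zero _).2 hx
    have hs' : algebraMap ℂ K s ≠ 0 := (map_ne_zero _).2 hs
    set v₁ := map (algebraMap ℂ K) u₁ with hv₁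
    set v₂ := map (algebraMap ℂ K) u₂ with hv₂
    have e1 : v₁ = C (algebraMap ℂ K x) * e2 K := by rw [hv₁, h1, map_mul, map_C, map_e2]
    have e2 : v₂ = C (algebraMap ℂ K s) * em K m + C (algebraMap ℂ K t) * e2 K ^ (m / 2) := by
      rw [hv₂, h2, map_add, map_mul, map_mul, map_pow, map_C, map_C, map_e2, map_em]
    -- The substitution is inverted: the hypothesis concerns `e₂, e_m`, and must be transported to
    -- the given generators.
    have f1 : Dihedral.e2 K = (algebraMap ℂ K x)⁻¹ • v₁ := by
      rw [e1, smul_eq_C_mul, ← mul_assoc, ← C_mul, inv_mul_cancel₀ hx', C_1, one_mul]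
    have f2 : em K m = (algebraMap ℂ K s)⁻¹ • v₂ +
        (-(algebraMap ℂ K s)⁻¹ * algebraMap ℂ K t * (algebraMap ℂ K x)⁻¹ ^ (m / 2)) •
          v₁ ^ (m / 2) := by
      have h3 : (C (algebraMap ℂ K s)⁻¹ * C (algebraMap ℂ K s) : MvPolynomial (Fin 2) K) = 1 := by
        rw [← C_mul, inv_mul_cancel₀ hs', C_1]
      rw [mul_smul, ← smul_pow, ← f1, e2]
      simp only [smul_eq_C_mul, C_mul, C_neg]
      linear_combination (-em K m) * h3
    refine ⟨r * s⁻¹ ^ k, mul_ne_zero hr (pow_ne_zero _ (inv_ne_zero hs)), ?_⟩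
    have h4 := lowerSpan_le f1 f2 k hb
    have h5 := Submodule.smul_mem _ (algebraMap ℂ K r) (pow_sub_smul_pow_mem_lowerSpan f2 k)
    have h6 := add_mem h4 h5
    convert h6 using 1
    have h7 : monom K u₁ u₂ (0, k) = v₂ ^ k := by simp [monom, hv₂]
    rw [h7]
    simp only [complex_smul_eq, smul_eq_C_mul, map_mul, map_pow, map_inv₀]
    ring
  · rintro ⟨i, l⟩ hl
    have hl' : l < k := by simpa [Prec] using hl
    obtain ⟨x, s, t, hx, hs, h1, h2⟩ := hu.exists_eq hm
    -- Without a factor `u₁` the degree `ml` is too small; with such a factor the monomial is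
    -- divisible by `e₂` and harmonicity applies.
    rcases i with _ | i
    · refine form_eq_zero_of_isHomogeneous (a := m * l) ?_ hhom
        (mul_lt_mul_of_pos_left hl' (by omega))
      simp only [monom, pow_zero, one_mul]
      exact (hu.2.1.pow l).map _
    · have e : monom K u₁ u₂ (i + 1, l) =
          e2 K * (C (algebraMap ℂ K x) * map (algebraMap ℂ K) (u₁ ^ i * u₂ ^ l)) := by
        rw [monom]
        simp only [pow_succ, map_mul]
        nth_rewrite 2 [h1]
        rw [map_mul, map_C, map_e2]
        ring
      rw [e, form_e2_mul_eq_zero hc hharm]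

/-- An invariant with leading term `e_m ^ k` has degree `mk`. -/
theorem degree_eq_of_sub_mem_lowerSpan {k : ℕ} {b : MvPolynomial (Fin 2) K} {d : ℕ}
    (hb : b.IsHomogeneous d) {r : ℂ} (hr : r ≠ 0)
    (h : b - r • em K m ^ k ∈ lowerSpan K (e2 K) (em K m) k) : d = m * k := by
  by_contra hd
  have hf : ∀ a : ℕ × ℕ, (e2 K ^ a.1 * em K m ^ a.2).IsHomogeneous (2 * a.1 + m * a.2) :=
    fun a => (e2_isHomogeneous.pow _).mul (em_isHomogeneous.pow _)
  -- At the point `(1, 0)` one has `e₂ = 0` and `e_m = 1`. A lower monomial of degree `mk` has fewer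
  -- than `k` factors `e_m`, so it contains `e₂` and vanishes there.
  have h1 : ∀ p ∈ lowerSpan K (e2 K) (em K m) k,
      eval ![1, 0] (homogeneousComponent (m * k) p) = 0 := by
    intro p hp
    induction hp using Submodule.span_induction with
    | mem p hp =>
      obtain ⟨⟨i, l⟩, hl, rfl⟩ := hp
      rw [Set.mem_ofPred_eq] at hl
      simp only at hl ⊢
      rw [homogeneousComponent_of_mem ((mem_homogeneousSubmodule _ _).2 (hf (i, l)))]
      split_ifs with hi
      · rcases i with _ | i
        · simp only [mul_zero, zero_add, mul_eq_mul_left_iff] at hi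
          have := NeZero.ne m
          omega
        · simp [e2]
      · simp
    | zero => simp
    | add p q _ _ hp hq => rw [map_add, map_add, hp, hq, add_zero]
    | smul a p _ hp => rw [map_smul, smul_eval, hp, mul_zero]
  have h2 := h1 _ h
  have h3 : (em K m ^ k).IsHomogeneous (m * k) := em_isHomogeneous.pow _
  rw [complex_smul_eq, map_sub, homogeneousComponent_C_mul,
    homogeneousComponent_of_mem ((mem_homogeneousSubmodule _ _).2 hb), if_neg (Ne.symm hd),
    homogeneousComponent_eq_self h3] at h2
  simp [em, NeZero.ne m, hr] at h2

variable {A : Type*} [CommRing A] [IsDomain A] [Algebra ℂ A] [Algebra A K] [IsScalarTower ℂ A K]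
  [FaithfulSMul A K]

/-- Homogeneity leaves finitely many monomials, so nondegeneracy applies to their complex span; that
span is stable under conjugation because `e₂` and `e_m` have real coefficients. -/
theorem eq_zero_of_mem_lowerSpan (ε : A →ₐ[ℂ] ℂ) {cA : ZMod m → A} {c : ZMod m → K}
    (hε : ∀ j, ε (cA j) = 0) (hcA : ∀ j, c j = algebraMap A K (cA j)) {k n : ℕ}
    {w : MvPolynomial (Fin 2) K} (hw : w ∈ lowerSpan K (e2 K) (em K m) k)
    (hhom : w.IsHomogeneous n)
    (h : ∀ i l, l < k → form c (e2 K ^ i * em K m ^ l) w = 0) : w = 0 := by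
  have hf : ∀ a : ℕ × ℕ, (e2 K ^ a.1 * em K m ^ a.2).IsHomogeneous (2 * a.1 + m * a.2) :=
    fun a => (e2_isHomogeneous.pow _).mul (em_isHomogeneous.pow _)
  have hw' := mem_span_of_isHomogeneous hf hhom hw
  set T : Set (ℕ × ℕ) := {a ∈ {a : ℕ × ℕ | a.2 < k} | 2 * a.1 + m * a.2 = n} with hT
  have hTfin : T.Finite := by
    refine ((Set.finite_Iic n).prod (Set.finite_Iio k)).subset ?_
    rintro ⟨i, l⟩ ⟨h1, h2⟩
    simp only [Set.mem_prod, Set.mem_Iic, Set.mem_Iio]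
    simp only [Set.mem_ofPred_eq] at h1 h2
    constructor
    · nlinarith [Nat.zero_le (m * l)]
    · exact h1
  let g : ℕ × ℕ → MvPolynomial (Fin 2) ℂ := fun a => e2 ℂ ^ a.1 * em ℂ m ^ a.2
  have hg : ∀ a, map (algebraMap ℂ K) (g a) = e2 K ^ a.1 * em K m ^ a.2 := fun a => by
    rw [map_mul, map_pow, map_pow, map_e2, map_em]
  have : FiniteDimensional ℂ (Submodule.span ℂ (g '' T)) :=
    FiniteDimensional.span_of_finite ℂ (hTfin.image g)
  refine eq_zero_of_forall_form_eq_zero ε hε hcA (Submodule.span ℂ (g '' T)) ?_ ?_ ?_ ?_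
  · intro f hf
    refine (Submodule.span_le (p := Subalgebra.toSubmodule (invariants ℂ m))).2 ?_ hf
    rintro _ ⟨a, -, rfl⟩
    exact Subalgebra.mul_mem _ (pow_mem e2_mem_invariants _) (pow_mem em_mem_invariants _)
  · intro f hf
    induction hf using Submodule.span_induction with
    | mem f hf =>
      obtain ⟨a, ha, rfl⟩ := hf
      refine Submodule.subset_span ⟨a, ha, ?_⟩
      rw [map_mul, map_pow, map_pow, map_e2, map_em]
    | zero => rw [map_zero]; exact zero_mem _
    | add p q _ _ hp hq => rw [map_add]; exact add_mem hp hq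
    | smul a p _ hp =>
      rw [smul_eq_C_mul, map_mul, map_C, ← smul_eq_C_mul]
      exact Submodule.smul_mem _ _ hp
  · refine Submodule.span_mono ?_ hw'
    rintro _ ⟨a, ha, rfl⟩
    exact ⟨g a, Submodule.subset_span ⟨a, ha, rfl⟩, hg a⟩
  · intro f hf
    induction hf using Submodule.span_induction with
    | mem f hf =>
      obtain ⟨a, ha, rfl⟩ := hf
      rw [hg]
      exact h _ _ ha.1
    | zero => rw [form_eq_formLin, map_zero, map_zero, LinearMap.zero_apply]
    | add p q _ _ hp hq =>
      rw [form_eq_formLin] at *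
      rw [map_add (map _), map_add (formLin c), LinearMap.add_apply, hp, hq, add_zero]
    | smul a p _ hp =>
      rw [form_eq_formLin] at *
      rw [smul_eq_C_mul, map_mul, map_C, ← smul_eq_C_mul, map_smul, LinearMap.smul_apply, hp,
        smul_zero]

/-- Homogeneous harmonic invariants with leading terms `e_m ^ k` are the canonical invariants, if
the parameters can be specialized to `0`. -/
theorem isCanonicalFamily_of_lap_eq_zero (hm : 3 ≤ m) (ε : A →ₐ[ℂ] ℂ) {cA : ZMod m → A}
    {c : ZMod m → K} (hε : ∀ j, ε (cA j) = 0) (hcA : ∀ j, c j = algebraMap A K (cA j))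
    (hc : ∀ i j, c (2 * j - i) = c i) {b : ℕ → MvPolynomial (Fin 2) K}
    (hinv : ∀ k, b k ∈ invariants K m) (hhom : ∀ k, (b k).IsHomogeneous (m * k))
    (hlap : ∀ k, lap c (b k) = 0)
    (hb : ∀ k, ∃ r : ℂ, r ≠ 0 ∧ b k - r • em K m ^ k ∈ lowerSpan K (e2 K) (em K m) k) :
    IsCanonicalFamily c b := by
  intro k
  obtain ⟨r, hr, hrb⟩ := hb k
  have hcan := isCanonical_of_lap_eq_zero hm hc (hinv k) (hhom k) (hlap k) hr hrb
  refine ⟨hcan, fun b' hb' => ?_⟩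
  obtain ⟨⟨d, hd⟩, -, h'⟩ := hb'
  obtain ⟨⟨r', hr', hrb'⟩, horth'⟩ := h' _ _ isGenerators_e2_em
  have horth := (hcan.2.2 _ _ isGenerators_e2_em).2
  rw [span_monom_eq_lowerSpan, map_e2, map_em, monom_e2_em] at hrb'
  simp only [pow_zero, one_mul] at hrb'
  have hdeg := degree_eq_of_sub_mem_lowerSpan hd hr' hrb'
  subst hdeg
  -- The factor matches the leading coefficients, so that the difference lies in the lower span.
  refine ⟨r' / r, div_ne_zero hr' hr, ?_⟩
  rw [← sub_eq_zero]
  refine eq_zero_of_mem_lowerSpan (k := k) (n := m * k) ε hε hcA ?_ ?_ ?_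
  · have := sub_mem hrb' (Submodule.smul_mem _ (algebraMap ℂ K (r' / r)) hrb)
    rw [algebraMap_smul, smul_sub, ← mul_smul, div_mul_cancel₀ _ hr] at this
    convert this using 1
    ring
  · rw [← algebraMap_smul K, smul_eq_C_mul]
    exact hd.sub ((hhom k).C_mul _)
  · intro i l hl
    have hp : Prec (i, l) (0, k) := Or.inl hl
    have h1 := horth' _ hp
    have h2 := horth _ hp
    rw [monom_e2_em, form_eq_formLin] at h1 h2
    rw [form_eq_formLin, ← algebraMap_smul K, map_sub, map_smul, h1, h2, smul_zero, sub_zero]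

end Canonical

/-! ### Telescoping, generalized binomials and the Laplacian of monomials -/

section Elementary

/-- The Laplacian of the `j`th term of a candidate splits as `f j + g j`, with `g (j + 1)`
proportional to the same monomial as `f j`; a two-term recurrence then gives harmonicity. -/
theorem sum_range_eq_zero_of_telescope {B : Type*} [AddCommGroup B] {f g : ℕ → B} {k : ℕ}
    (h0 : g 0 = 0) (hk : f k = 0) (h : ∀ j < k, f j + g (j + 1) = 0) :
    ∑ j ∈ Finset.range (k + 1), (f j + g j) = 0 := by
  rw [Finset.sum_add_distrib, Finset.sum_range_succ, Finset.sum_range_succ' g, hk, h0, add_zero,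
    add_zero, ← Finset.sum_add_distrib]
  exact Finset.sum_eq_zero fun j hj => h j (Finset.mem_range.1 hj)

variable {K : Type*} [Field K] [CharZero K]

theorem choose_succ_mul (c : K) (n : ℕ) :
    Ring.choose c (n + 1) * (n + 1) = Ring.choose c n * (c - n) := by
  have h1 : ((n + 1).factorial : K) * Ring.choose c (n + 1) =
      (n.factorial : K) * Ring.choose c n * (c - n) := by
    rw [← nsmul_eq_mul, ← nsmul_eq_mul, ← Ring.descPochhammer_eq_factorial_smul_choose,
      ← Ring.descPochhammer_eq_factorial_smul_choose, descPochhammer_succ_right,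
      Polynomial.smeval_mul, Polynomial.smeval_sub, Polynomial.smeval_X, Polynomial.smeval_natCast]
    simp
  have h2 : (n.factorial : K) ≠ 0 := by exact_mod_cast n.factorial_ne_zero
  rw [Nat.factorial_succ] at h1
  push_cast at h1
  apply mul_left_cancel₀ h2
  linear_combination h1

theorem choose_ne_zero {c : K} {k : ℕ} (h : ∀ i < k, c ≠ i) :
    Ring.choose c k ≠ 0 := by
  induction k with
  | zero => simp
  | succ k ih =>
    have h1 := choose_succ_mul c k
    have h2 := mul_ne_zero (ih fun i hi => h i (by omega)) (sub_ne_zero.2 (h k (by omega)))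
    rw [← h1] at h2
    exact left_ne_zero_of_mul h2

end Elementary

section Sums

variable {K : Type*} [Field K] [Algebra ℂ K] {m : ℕ} [NeZero m]

theorem sum_zeta_pow (n : ℕ) :
    ∑ j : ZMod m, zeta K m j ^ n = if (n : ZMod m) = 0 then (m : K) else 0 := by
  have h : ∀ j : ZMod m, zeta K m j ^ n = algebraMap ℂ K (ZMod.stdAddChar (j * (n : ZMod m))) := by
    intro j
    rw [← zeta_natCast_mul, mul_comm, zeta]
  simp only [h]
  rw [← map_sum, AddChar.sum_mulShift _ (ZMod.isPrimitive_stdAddChar m), ZMod.card]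
  split_ifs <;> simp

variable {c : ZMod m → K}

/-- Wherever subtraction truncates an exponent, the coefficient in front is zero, so no case
distinction on `a` and `b` is needed. -/
theorem lap_pow_mul_pow {f g : MvPolynomial (Fin 2) K} (hf : f ∈ invariants K m)
    (hg : g ∈ invariants K m) (a b : ℕ) : lap c (f ^ a * g ^ b) =
      a * f ^ (a - 1) * g ^ b * lap c f + b * f ^ a * g ^ (b - 1) * lap c g +
      a * (a - 1 : ℕ) * f ^ (a - 2) * g ^ b * (pderiv 0 f * pderiv 1 f) +
      b * (b - 1 : ℕ) * f ^ a * g ^ (b - 2) * (pderiv 0 g * pderiv 1 g) +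
      a * b * f ^ (a - 1) * g ^ (b - 1) *
        (pderiv 0 f * pderiv 1 g + pderiv 1 f * pderiv 0 g) := by
  have hpow : ∀ {f : MvPolynomial (Fin 2) K}, f ∈ invariants K m → ∀ a : ℕ,
      lap c (f ^ a) = a * f ^ (a - 1) * lap c f +
        a * (a - 1 : ℕ) * f ^ (a - 2) * (pderiv 0 f * pderiv 1 f) := by
    intro f hf a
    rcases a with _ | a
    · simpa using lap_C (c := c) 1
    · rw [lap_pow_succ hf, Nat.add_sub_cancel, show a + 1 - 2 = a - 1 by omega]
      push_cast
      ring
  rw [lap_mul (pow_mem hf _) (pow_mem hg _), hpow hf, hpow hg]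
  simp only [pderiv_pow]
  ring

end Sums

theorem natCast_mul_pow_pred_mul {B : Type*} [CommRing B] (x : B) (a : ℕ) :
    (a : B) * x ^ (a - 1) * x = a * x ^ a := by
  rcases a with _ | a
  · simp
  · rw [Nat.add_sub_cancel]
    ring

theorem natCast_mul_pow_pred_pred_mul {B : Type*} [CommRing B] (x : B) (a : ℕ) :
    (a : B) * (a - 1 : ℕ) * x ^ (a - 2) * x = a * (a - 1) * x ^ (a - 1) := by
  rcases a with _ | _ | a
  · simp
  · simp
  · rw [Nat.add_sub_cancel, show a + 1 + 1 - 2 = a by omega]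
    push_cast
    ring

/-! ### Equal parameters: the explicit invariants -/

section Gegenbauer

variable {K : Type*} [Field K]

theorem pderiv_em (m : ℕ) (i : Fin 2) : pderiv i (em K m) = C (m : K) * X i ^ (m - 1) := by
  fin_cases i <;> simp [em, pderiv_X]

theorem pderiv_e2_pow (l : ℕ) : pderiv 0 (e2 K ^ l) = C (l : K) * e2 K ^ (l - 1) * X 1 ∧
    pderiv 1 (e2 K ^ l) = C (l : K) * e2 K ^ (l - 1) * X 0 := by
  have h0 : pderiv 0 (e2 K) = X 1 := by simp [e2, pderiv_X]
  have h1 : pderiv 1 (e2 K) = X 0 := by simp [e2, pderiv_X]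
  rw [pderiv_pow, pderiv_pow, h0, h1, map_natCast]
  exact ⟨rfl, rfl⟩

variable [CharZero K]

/-- The canonical invariant `b_{(0,k)}` for equal parameters. -/
def gegenbauer (c : K) (m k : ℕ) : MvPolynomial (Fin 2) K :=
  ∑ j ∈ Finset.range (k + 1),
    C (Ring.choose c (k - j) * ((k - j).choose j : K) / Ring.choose c k) *
      (em K m ^ (k - 2 * j) * (e2 K ^ m) ^ j)

theorem gegenbauer_isHomogeneous (c : K) (m k : ℕ) :
    (gegenbauer c m k).IsHomogeneous (m * k) := by
  refine IsHomogeneous.sum _ _ _ fun j _ => ?_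
  by_cases hj : 2 * j ≤ k
  · have h := ((em_isHomogeneous (K := K) (m := m)).pow (k - 2 * j)).mul
      ((e2_isHomogeneous.pow m).pow j)
    have e : m * (k - 2 * j) + 2 * m * j = m * k := by
      obtain ⟨d, rfl⟩ := Nat.exists_eq_add_of_le hj
      rw [Nat.add_sub_cancel_left]
      ring
    rw [e] at h
    exact h.C_mul _
  · rw [Nat.choose_eq_zero_of_lt (by omega : k - j < j)]
    simpa using isHomogeneous_zero _ _ _

/-- The cancellation required for harmonicity. It combines `(c - n) binom(c, n) = (n + 1) binom(c, n
+ 1)` for `n = k - j - 1` with the two neighbour relations for the integer binomials. -/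
theorem choose_recurrence (c : K) {j k : ℕ} (hj : j < k) :
    Ring.choose c (k - j) * ((k - j).choose j : K) *
        ((k - 2 * j : ℕ) * (k - 2 * j - 1 : ℕ)) +
      Ring.choose c (k - (j + 1)) * ((k - (j + 1)).choose (j + 1) : K) *
        ((j + 1 : ℕ) * ((j + 1 : ℕ) + (k - 2 * (j + 1) : ℕ) - c)) = 0 := by
  by_cases hk : 2 * j + 2 ≤ k
  · obtain ⟨d, rfl⟩ := Nat.exists_eq_add_of_le hk
    have e1 : 2 * j + 2 + d - j = (j + d + 1) + 1 := by omega
    have e2 : 2 * j + 2 + d - 2 * j = d + 2 := by omega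
    have e3 : 2 * j + 2 + d - (j + 1) = j + d + 1 := by omega
    have e4 : 2 * j + 2 + d - 2 * (j + 1) = d := by omega
    rw [e1, e2, e3, e4, show d + 2 - 1 = d + 1 by omega]
    have h1 := choose_succ_mul c (j + d + 1)
    have h2 := Nat.choose_mul_succ_eq (j + d + 1) j
    have h3 := Nat.choose_succ_right_eq (j + d + 1) j
    rw [show j + d + 1 + 1 - j = d + 2 by omega] at h2
    rw [show j + d + 1 - j = d + 1 by omega] at h3
    have h2' := congrArg (Nat.cast (R := K)) h2
    have h3' := congrArg (Nat.cast (R := K)) h3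
    push_cast at h1 h2' h3' ⊢
    linear_combination (-Ring.choose c (j + d + 1 + 1) * (d + 1)) * h2' -
      Ring.choose c (j + d + 1 + 1) * (j + d + 1 + 1) * h3' +
      (((j + d + 1).choose (j + 1) : K) * (j + 1)) * h1
  · rw [Nat.choose_eq_zero_of_lt (by omega : k - (j + 1) < j + 1)]
    have : k - 2 * j = 0 ∨ k - 2 * j - 1 = 0 := by omega
    rcases this with h | h <;> simp [h]

theorem gegenbauer_sub_mem_lowerSpan {c : K} (hc : ∀ n : ℕ, c ≠ n) (m k : ℕ) :
    gegenbauer c m k - em K m ^ k ∈ lowerSpan K (e2 K) (em K m) k := by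
  have h0 := choose_ne_zero (c := c) (k := k) fun i _ => hc i
  rw [gegenbauer, Finset.sum_range_succ']
  have e : C (Ring.choose c (k - 0) * ((k - 0).choose 0 : K) / Ring.choose c k) *
      (em K m ^ (k - 2 * 0) * (e2 K ^ m) ^ 0) = em K m ^ k := by
    simp [h0]
  rw [e, add_sub_cancel_right]
  refine sum_mem fun j hj => ?_
  rw [Finset.mem_range] at hj
  rw [← smul_eq_C_mul, mul_comm (em K m ^ _), ← pow_mul]
  exact Submodule.smul_mem _ _ (monomial_mem_lowerSpan _ _ _ (by omega))

theorem mk_choose_smul_gegenbauer {c : K} (hc : ∀ n : ℕ, c ≠ n) (m : ℕ) :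
    PowerSeries.mk (fun k => Ring.choose c k • gegenbauer c m k) =
      (PowerSeries.binomialSeries (MvPolynomial (Fin 2) K) c).subst
        (PowerSeries.C (em K m) * PowerSeries.X +
          PowerSeries.C (e2 K ^ m) * PowerSeries.X ^ 2 : PowerSeries (MvPolynomial (Fin 2) K)) := by
  set a : PowerSeries (MvPolynomial (Fin 2) K) := PowerSeries.C (em K m) * PowerSeries.X +
    PowerSeries.C (e2 K ^ m) * PowerSeries.X ^ 2 with ha
  have hsubst : PowerSeries.HasSubst a :=
    PowerSeries.HasSubst.of_constantCoeff_zero' (by simp [ha])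
  have hpow : ∀ d, a ^ d = ∑ i ∈ Finset.range (d + 1),
      PowerSeries.C ((d.choose i : MvPolynomial (Fin 2) K) *
        ((e2 K ^ m) ^ i * em K m ^ (d - i))) * PowerSeries.X ^ (d + i) := by
    intro d
    rw [ha, add_comm, add_pow]
    refine Finset.sum_congr rfl fun i hi => ?_
    rw [Finset.mem_range] at hi
    obtain ⟨e, rfl⟩ := Nat.exists_eq_add_of_le (Nat.lt_succ_iff.1 hi)
    rw [Nat.add_sub_cancel_left]
    simp only [map_mul, map_pow, map_natCast]
    ring
  ext1 k
  rw [PowerSeries.coeff_mk, PowerSeries.coeff_subst' hsubst, finsum_eq_sum_of_support_subset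
    (s := Finset.range (k + 1))]
  -- The `d`th power of the substituted series meets `t ^ k` only in its term with `i = k - d`,
  -- which is the summand `j = k - d` of `gegenbauer`.
  · rw [gegenbauer, Finset.smul_sum, ← Finset.sum_range_reflect]
    refine Finset.sum_congr rfl fun d hd => ?_
    rw [Finset.mem_range] at hd
    have h0 := choose_ne_zero (c := c) (k := k) fun i _ => hc i
    rw [hpow, map_sum, PowerSeries.binomialSeries_coeff]
    simp only [PowerSeries.coeff_C_mul, PowerSeries.coeff_X_pow, mul_ite, mul_one, mul_zero]
    obtain ⟨e, rfl⟩ := Nat.exists_eq_add_of_le (Nat.lt_succ_iff.1 hd)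
    have e1 : d + e + 1 - 1 - d = e := by omega
    rw [e1, Nat.add_sub_cancel]
    simp only [add_right_inj]
    rw [Finset.sum_ite_eq, smul_eq_C_mul, smul_eq_C_mul, ← mul_assoc, ← C_mul, mul_div_cancel₀ _ h0,
      smul_eq_mul, C_mul]
    split_ifs with hed
    · rw [show d + e - 2 * e = d - e by omega, map_natCast]
      ring
    · rw [Finset.mem_range, not_lt] at hed
      rw [Nat.choose_eq_zero_of_lt (by omega)]
      simp
  · intro d hd
    rw [Finset.coe_range, Set.mem_Iio]
    by_contra hkd
    refine hd ?_
    beta_reduce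
    rw [hpow, map_sum, Finset.sum_eq_zero, smul_zero]
    intro i _
    rw [PowerSeries.coeff_C_mul, PowerSeries.coeff_X_pow, if_neg (by omega), mul_zero]

end Gegenbauer

/-! ### Equal parameters: harmonicity and generating function -/

section EqualParameters

variable {K : Type*} [Field K] [Algebra ℂ K] {m : ℕ} [NeZero m]

theorem lap_e2_pow (c : ZMod m → K) (l : ℕ) :
    lap c (e2 K ^ l) = C (l * (l - ∑ j, c j) : K) * e2 K ^ (l - 1) := by
  rcases l with _ | l
  · simpa using lap_C (c := c) 1
  have h0 : pderiv 0 (e2 K) = X 1 := by simp [e2, pderiv_X]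
  have h1 : pderiv 1 (e2 K) = X 0 := by simp [e2, pderiv_X]
  have h2 := natCast_mul_pow_pred_mul (e2 K) l
  rw [lap_pow_succ e2_mem_invariants, lap_e2, h0, h1, Nat.add_sub_cancel]
  simp only [map_sub, map_mul, map_natCast, map_one, Nat.cast_succ, map_add]
  rw [show X 1 * X 0 = e2 K from mul_comm _ _]
  linear_combination ((l : MvPolynomial (Fin 2) K) + 1) * h2

/-- The Fourier coefficients of a constant vanish at the frequencies `1, …, m - 1`, the only ones
occurring in `lap_em`. -/
theorem lap_em_const (c : K) (hm : 2 ≤ m) : lap (fun _ : ZMod m => c) (em K m) = 0 := by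
  rw [lap_em, Finset.sum_eq_zero, mul_zero]
  intro i hi
  rw [Finset.mem_range] at hi
  rw [← Finset.mul_sum, sum_zeta_pow, if_neg, mul_zero, C_0, zero_mul]
  rw [ZMod.natCast_eq_zero_iff]
  intro h
  have := Nat.le_of_dvd (Nat.succ_pos i) h
  omega

theorem lap_em_pow_mul_e2_pow (hm : 2 ≤ m) (c : K) (a l : ℕ) :
    lap (fun _ : ZMod m => c) (em K m ^ a * (e2 K ^ m) ^ l) =
      C (m : K) ^ 2 * e2 K ^ (m - 1) *
        (C (a * (a - 1 : ℕ) : K) * (em K m ^ (a - 2) * (e2 K ^ m) ^ l) +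
          C (l * (l + a - c) : K) * (em K m ^ a * (e2 K ^ m) ^ (l - 1))) := by
  have hP : e2 K ^ (m - 1) * (X 0 * X 1) = e2 K ^ m := by
    rw [← e2, ← pow_succ]
    congr 1
    omega
  have hX : ∀ i : Fin 2, (X i ^ (m - 1) * X i : MvPolynomial (Fin 2) K) = X i ^ m := by
    intro i
    rw [← pow_succ]
    congr 1
    omega
  have hQ : (X 0 ^ (m - 1) * X 1 ^ (m - 1) : MvPolynomial (Fin 2) K) = e2 K ^ (m - 1) := by
    rw [e2, mul_pow]
  rw [lap_pow_mul_pow em_mem_invariants (pow_mem e2_mem_invariants m), lap_em_const c hm,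
    lap_e2_pow, (pderiv_e2_pow m).1, (pderiv_e2_pow m).2, pderiv_em m, pderiv_em m]
  have h1 := natCast_mul_pow_pred_mul (em K m) a
  have h2 := natCast_mul_pow_pred_pred_mul (e2 K ^ m) l
  simp only [Finset.sum_const, Finset.card_univ, ZMod.card, nsmul_eq_mul, map_sub, map_mul,
    map_natCast, map_add]
  set P := e2 K ^ m
  set Q := e2 K ^ (m - 1)
  set e := em K m with he
  rw [em, ← hX 0, ← hX 1] at he
  linear_combination (m ^ 2 * a * (a - 1 : ℕ) * e ^ (a - 2) * P ^ l) * hQ +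
    m ^ 2 * Q * e ^ a * h2 + (m ^ 2 * Q * l * (l - 1 : ℕ) * e ^ a * P ^ (l - 2)) * hP +
    (m ^ 2 * Q * l * P ^ (l - 1)) * h1 - (a * l * e ^ (a - 1) * P ^ (l - 1) * m ^ 2 * Q) * he

variable [CharZero K]

theorem gegenbauer_mem_invariants (c : K) (k : ℕ) : gegenbauer c m k ∈ invariants K m :=
  sum_mem fun _ _ => mul_mem (C_mem_invariants _)
    (mul_mem (pow_mem em_mem_invariants _) (pow_mem (pow_mem e2_mem_invariants _) _))

theorem lap_gegenbauer (hm : 2 ≤ m) (c : K) (k : ℕ) :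
    lap (fun _ : ZMod m => c) (gegenbauer c m k) = 0 := by
  rw [gegenbauer, lap_sum]
  have h : ∀ j, lap (fun _ : ZMod m => c)
      (C (Ring.choose c (k - j) * ((k - j).choose j : K) / Ring.choose c k) *
        (em K m ^ (k - 2 * j) * (e2 K ^ m) ^ j)) =
      C (m : K) ^ 2 * e2 K ^ (m - 1) *
        (C (Ring.choose c (k - j) * ((k - j).choose j : K) *
            ((k - 2 * j : ℕ) * (k - 2 * j - 1 : ℕ)) / Ring.choose c k) *
            (em K m ^ (k - 2 * j - 2) * (e2 K ^ m) ^ j) +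
          C (Ring.choose c (k - j) * ((k - j).choose j : K) * (j * (j + (k - 2 * j : ℕ) - c)) /
            Ring.choose c k) * (em K m ^ (k - 2 * j) * (e2 K ^ m) ^ (j - 1))) := by
    intro j
    rw [lap_C_mul _ (mul_mem (pow_mem em_mem_invariants _)
      (pow_mem (pow_mem e2_mem_invariants _) _)), lap_em_pow_mul_e2_pow hm]
    simp only [div_eq_mul_inv, C_mul]
    ring
  simp only [h]
  rw [← Finset.mul_sum, sum_range_eq_zero_of_telescope, mul_zero]
  · simp
  · rw [show k - 2 * k = 0 by omega]
    simp
  · intro j hj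
    rw [Nat.add_sub_cancel, show k - 2 * (j + 1) = k - 2 * j - 2 by omega, ← add_mul, ← C_add,
      ← add_div, show k - 2 * j - 2 = k - 2 * (j + 1) by omega, choose_recurrence c hj]
    simp

end EqualParameters

theorem exists_isCanonicalFamily_equal_parameters (m : ℕ) [NeZero m] (hm : 3 ≤ m) :
    ∃ b : ℕ → MvPolynomial (Fin 2) (RatFunc ℂ),
      IsCanonicalFamily (fun _ : ZMod m => (RatFunc.X : RatFunc ℂ)) b ∧
      PowerSeries.mk (fun k => Ring.choose (RatFunc.X : RatFunc ℂ) k • b k) =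
        (PowerSeries.binomialSeries (MvPolynomial (Fin 2) (RatFunc ℂ))
          (RatFunc.X : RatFunc ℂ)).subst
          (PowerSeries.C (em (RatFunc ℂ) m) * PowerSeries.X +
            PowerSeries.C (e2 (RatFunc ℂ) ^ m) * PowerSeries.X ^ 2 :
            PowerSeries (MvPolynomial (Fin 2) (RatFunc ℂ))) := by
  have hX : ∀ n : ℕ, (RatFunc.X : RatFunc ℂ) ≠ n := by
    intro n h
    rw [← RatFunc.algebraMap_X, ← map_natCast (algebraMap (Polynomial ℂ) (RatFunc ℂ))] at h
    exact Polynomial.X_ne_C (n : ℂ) (by simpa using RatFunc.algebraMap_injective ℂ h)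
  refine ⟨gegenbauer RatFunc.X m, ?_, mk_choose_smul_gegenbauer hX m⟩
  refine isCanonicalFamily_of_lap_eq_zero hm (Polynomial.aeval (0 : ℂ))
    (cA := fun _ => Polynomial.X) (by simp) (by simp) (fun _ _ => rfl)
    (gegenbauer_mem_invariants _) (gegenbauer_isHomogeneous _ m) (lap_gegenbauer (by omega) _) ?_
  exact fun k => ⟨1, one_ne_zero, by simpa using gegenbauer_sub_mem_lowerSpan hX m k⟩

/-! ### Two parameters: coefficients and their recurrence -/

section JacobiCoefficients

theorem ascPochhammer_eval_succ_left {R : Type*} [CommRing R] (n : ℕ) (x : R) :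
    (ascPochhammer R (n + 1)).eval x = x * (ascPochhammer R n).eval (x + 1) := by
  rw [ascPochhammer_succ_left]
  simp [Polynomial.eval_comp]

theorem ascPochhammer_eval_add {R : Type*} [CommRing R] (n k : ℕ) (x : R) :
    (ascPochhammer R (n + k)).eval x =
      (ascPochhammer R n).eval x * (ascPochhammer R k).eval (x + n) := by
  rw [← ascPochhammer_mul]
  simp [Polynomial.eval_comp]

theorem ascPochhammer_eval_ne_zero {R : Type*} [CommRing R] [IsDomain R] {n : ℕ} {x : R}
    (h : ∀ i < n, x + i ≠ 0) : (ascPochhammer R n).eval x ≠ 0 := by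
  induction n with
  | zero => simp
  | succ n ih =>
    rw [ascPochhammer_succ_eval]
    exact mul_ne_zero (ih fun i hi => h i (by omega)) (h n (by omega))

/-- The coefficients of the canonical invariants for two parameters, where `s = c₁ + c₂`. -/
def jacobiCoeff {F : Type*} [Field F] (s c₂ : F) (k j : ℕ) : F :=
  (ascPochhammer F (k - j)).eval (2⁻¹ - c₂ + j) /
    (j.factorial * (k - j).factorial * (ascPochhammer F (k - j)).eval (k - s + j))

theorem jacobiCoeff_self {F : Type*} [Field F] (s c₂ : F) (k : ℕ) :
    jacobiCoeff s c₂ k k = (k.factorial : F)⁻¹ := by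
  simp [jacobiCoeff]

variable {F : Type*} [Field F]

theorem natCast_sub_add_ne_zero {s : F} (hs : ∀ n : ℕ, s ≠ n) (k j : ℕ) :
    (k : F) - s + j ≠ 0 := by
  intro h
  apply hs (k + j)
  push_cast
  linear_combination -h

theorem ascPochhammer_natCast_sub_ne_zero {s : F} (hs : ∀ n : ℕ, s ≠ n) (n k j : ℕ) :
    (ascPochhammer F n).eval (k - s + j) ≠ 0 :=
  ascPochhammer_eval_ne_zero fun i _ => by
    rw [add_assoc, ← Nat.cast_add]
    exact natCast_sub_add_ne_zero hs k (j + i)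

/-- Passing from `j` to `j + 1` removes the first factor of each Pochhammer symbol. The denominators
are products of `n - s` with `n` natural, so they vanish only for natural `s`. -/
theorem jacobiCoeff_recurrence [CharZero F] {s c₂ : F} (hs : ∀ n : ℕ, s ≠ n) {j k : ℕ}
    (hj : j < k) :
    jacobiCoeff s c₂ k j * ((k - j : ℕ) * ((k - j : ℕ) - s + 2 * j)) =
      jacobiCoeff s c₂ k (j + 1) * ((j + 1 : ℕ) * (2⁻¹ - c₂ + (j + 1 : ℕ) - 1)) := by
  obtain ⟨i, rfl⟩ := Nat.exists_eq_add_of_lt hj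
  have e1 : j + i + 1 - j = i + 1 := by omega
  have e2 : j + i + 1 - (j + 1) = i := by omega
  have h1 := natCast_sub_add_ne_zero hs (j + i + 1) j
  have h2 := ascPochhammer_natCast_sub_ne_zero hs i (j + i + 1) (j + 1)
  have h3 : (j.factorial : F) ≠ 0 := by exact_mod_cast j.factorial_ne_zero
  have h4 : (i.factorial : F) ≠ 0 := by exact_mod_cast i.factorial_ne_zero
  have h5 : (i + 1 : F) ≠ 0 := by exact_mod_cast i.succ_ne_zero
  have h6 : (j + 1 : F) ≠ 0 := by exact_mod_cast j.succ_ne_zero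
  rw [jacobiCoeff, jacobiCoeff, e1, e2, ascPochhammer_eval_succ_left,
    ascPochhammer_eval_succ_left, Nat.factorial_succ, Nat.factorial_succ]
  push_cast at h1 h2 ⊢
  rw [show (2⁻¹ - c₂ + (j : F) + 1) = 2⁻¹ - c₂ + (j + 1) by ring,
    show (j + i + 1 - s + j + 1 : F) = j + i + 1 - s + (j + 1) by ring]
  field_simp
  ring

end JacobiCoefficients

/-! ### Two parameters: the explicit invariants and harmonicity -/

section TwoParameters

/-- The polynomial `e_m / 4 - e₂ ^ (m/2) / 2` over a field. -/
def quarter (F : Type*) [Field F] (m : ℕ) : MvPolynomial (Fin 2) F :=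
  C (1 / 4) * em F m - C (1 / 2) * e2 F ^ (m / 2)

/-- The canonical invariant `b_{(0,k)}` for two parameters, where `s = c₁ + c₂`. -/
def jacobiInv {F : Type*} [Field F] (m : ℕ) (s c₂ : F) (k : ℕ) : MvPolynomial (Fin 2) F :=
  ∑ j ∈ Finset.range (k + 1),
    C (jacobiCoeff s c₂ k j) * (quarter F m ^ j * (e2 F ^ (m / 2)) ^ (k - j))

theorem quarter_isHomogeneous {F : Type*} [Field F] {m : ℕ} (hm : Even m) :
    (quarter F m).IsHomogeneous m := by
  have h := (e2_isHomogeneous (K := F)).pow (m / 2)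
  rw [Nat.mul_div_cancel' hm.two_dvd] at h
  exact (em_isHomogeneous.C_mul _).sub (h.C_mul _)

theorem jacobiInv_isHomogeneous {F : Type*} [Field F] {m : ℕ} (hm : Even m) (s c₂ : F) (k : ℕ) :
    (jacobiInv m s c₂ k).IsHomogeneous (m * k) := by
  have h := (e2_isHomogeneous (K := F)).pow (m / 2)
  rw [Nat.mul_div_cancel' hm.two_dvd] at h
  refine IsHomogeneous.sum _ _ _ fun j hj => ?_
  have h1 := ((quarter_isHomogeneous (F := F) hm).pow j).mul (h.pow (k - j))
  rw [Finset.mem_range] at hj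
  rw [← mul_add, Nat.add_sub_cancel' (by omega)] at h1
  exact h1.C_mul _

theorem jacobiInv_sub_mem_lowerSpan {F : Type*} [Field F] [CharZero F] (m : ℕ) (s c₂ : F)
    (k : ℕ) : jacobiInv m s c₂ k - ((k.factorial : F)⁻¹ * (1 / 4) ^ k) • em F m ^ k ∈
      lowerSpan F (e2 F) (em F m) k := by
  have hq : quarter F m = (1 / 4 : F) • em F m + (-(1 / 2) : F) • e2 F ^ (m / 2) := by
    rw [quarter, smul_eq_C_mul, smul_eq_C_mul, C_neg]
    ring
  have h := pow_sub_smul_pow_mem_lowerSpan hq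
  rw [jacobiInv, Finset.sum_range_succ, jacobiCoeff_self, Nat.sub_self, pow_zero, mul_one,
    add_sub_assoc]
  refine add_mem (sum_mem fun j hj => ?_) ?_
  · rw [Finset.mem_range] at hj
    have h1 := mul_mem_lowerSpan (K := F) (lowerSpan_mono _ _ (Nat.le_succ j) (h j))
      (m / 2 * (k - j)) 0
    have h2 := monomial_mem_lowerSpan (K := F) (e2 F) (em F m) (m / 2 * (k - j))
      (Nat.lt_succ_self j)
    have h3 := add_mem h1 (Submodule.smul_mem _ ((1 / 4 : F) ^ j) h2)
    rw [pow_zero, mul_one, mul_sub, mul_smul_comm, sub_add_cancel] at h3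
    rw [← smul_eq_C_mul, ← pow_mul, mul_comm (quarter F m ^ j)]
    exact Submodule.smul_mem _ _ (lowerSpan_mono _ _ (by omega) h3)
  · have h1 := Submodule.smul_mem _ ((k.factorial : F)⁻¹) (h k)
    rwa [smul_sub, ← mul_smul, smul_eq_C_mul (quarter F m ^ k)] at h1

variable {K : Type*} [Field K] [Algebra ℂ K] {m : ℕ} [NeZero m]

theorem quarter_mem_invariants : quarter K m ∈ invariants K m :=
  sub_mem (mul_mem (C_mem_invariants _) em_mem_invariants)
    (mul_mem (C_mem_invariants _) (pow_mem e2_mem_invariants _))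

theorem jacobiInv_mem_invariants (s c₂ : K) (k : ℕ) : jacobiInv m s c₂ k ∈ invariants K m :=
  sum_mem fun _ _ => mul_mem (C_mem_invariants _)
    (mul_mem (pow_mem quarter_mem_invariants _) (pow_mem (pow_mem e2_mem_invariants _) _))

/-- A parameter function depending on the parity of `j` has only the frequencies `0` and `n = m /
2`, since `ζ ^ (jn) = (-1) ^ j`. Below, `p = C / 2` and `q = δ / 2`. -/
theorem sum_mul_zeta_pow {n : ℕ} (hn : m = 2 * n) (p q : K) (i : ℕ) (hi : i < m) :
    ∑ j : ZMod m, (p + q * zeta K m j ^ n) * zeta K m j ^ i =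
      if i = 0 then m * p else if i = n then m * q else 0 := by
  have hm := NeZero.ne m
  have e : ∀ j : ZMod m, (p + q * zeta K m j ^ n) * zeta K m j ^ i =
      p * zeta K m j ^ i + q * zeta K m j ^ (n + i) := by
    intro j
    rw [pow_add]
    ring
  simp only [e, Finset.sum_add_distrib, ← Finset.mul_sum, sum_zeta_pow, ZMod.natCast_eq_zero_iff]
  have h1 : m ∣ i ↔ i = 0 :=
    ⟨fun h => Nat.eq_zero_of_dvd_of_lt h hi, fun h => h ▸ dvd_zero m⟩
  have h2 : m ∣ n + i ↔ i = n := by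
    constructor
    · rintro ⟨a, ha⟩
      rcases a with _ | _ | a
      · omega
      · omega
      · nlinarith
    · rintro rfl
      exact ⟨1, by omega⟩
  simp only [h1, h2]
  by_cases hi0 : i = 0
  · rw [if_pos hi0, if_pos hi0, if_neg (by omega)]
    ring
  · rw [if_neg hi0, if_neg hi0]
    split_ifs <;> ring

variable {c : ZMod m → K} {p q : K} {n : ℕ}

theorem lap_em_of_two_parameters (hn : m = 2 * n) (hc : ∀ j, c j = p + q * zeta K m j ^ n) :
    lap c (em K m) = C (m * (m * q) : K) * e2 K ^ (n - 1) := by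
  have hm := NeZero.ne m
  rw [lap_em, Finset.sum_eq_single (n - 1)]
  · simp only [hc]
    rw [sum_mul_zeta_pow hn p q _ (by omega), if_neg (by omega), if_pos (by omega),
      show m - 2 - (n - 1) = n - 1 by omega, e2, mul_pow]
    simp only [C_mul]
    ring
  · intro i hi hin
    rw [Finset.mem_range] at hi
    simp only [hc]
    rw [sum_mul_zeta_pow hn p q _ (by omega), if_neg (by omega), if_neg (by omega), C_0, zero_mul]
  · intro h
    rw [Finset.mem_range] at h
    omega

theorem lap_quarter_pow_mul_e2_pow [CharZero K] (hn : m = 2 * n)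
    (hc : ∀ j, c j = p + q * zeta K m j ^ n) (a l : ℕ) :
    lap c (quarter K m ^ a * (e2 K ^ (m / 2)) ^ l) =
      C (n : K) ^ 2 * e2 K ^ (n - 1) *
        (C (l * (l - (2 * p) + 2 * a) : K) *
            (quarter K m ^ a * (e2 K ^ (m / 2)) ^ (l - 1)) -
          C (a * (2⁻¹ - (p + q) + a - 1) : K) *
            (quarter K m ^ (a - 1) * (e2 K ^ (m / 2)) ^ l)) := by
  have hm := NeZero.ne m
  have hm2 : m / 2 = n := by omega
  have hsum : ∑ j, c j = m * p := by
    have := sum_mul_zeta_pow hn p q 0 (by omega)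
    simpa [hc] using this
  have hEinv : quarter K m ∈ invariants K m := quarter_mem_invariants
  have hPinv : e2 K ^ n ∈ invariants K m := pow_mem e2_mem_invariants n
  have hlapP : lap c (e2 K ^ n) = C (n ^ 2 * (1 - 2 * p) : K) * e2 K ^ (n - 1) := by
    rw [lap_e2_pow, hsum, hn]
    congr 2
    push_cast
    ring
  have hlapE : lap c (quarter K m) = C (n ^ 2 * (p + q - 2⁻¹) : K) * e2 K ^ (n - 1) := by
    rw [quarter, hm2, sub_eq_add_neg, ← neg_mul, ← C_neg, lap_add, lap_C_mul _ em_mem_invariants,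
      lap_C_mul _ hPinv, lap_em_of_two_parameters hn hc, hlapP]
    simp only [← mul_assoc, ← C_mul, ← add_mul, ← C_add]
    congr 2
    rw [hn]
    push_cast
    ring
  have hX : ∀ i : Fin 2, (X i ^ n : MvPolynomial (Fin 2) K) = X i ^ (n - 1) * X i := by
    intro i
    rw [← pow_succ]
    congr 1
    omega
  have hX' : ∀ i : Fin 2, (X i ^ (m - 1) : MvPolynomial (Fin 2) K) =
      X i ^ (n - 1) * (X i ^ (n - 1) * X i) := by
    intro i
    rw [← hX, ← pow_add]
    congr 1
    omega
  have h4 : (C (1 / 4) * 4 : MvPolynomial (Fin 2) K) = 1 := by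
    rw [← map_ofNat C, ← C_mul]
    norm_num
  have h2 : (C (1 / 2) : MvPolynomial (Fin 2) K) = 2 * C (1 / 4) := by
    rw [← map_ofNat C, ← C_mul]
    norm_num
  have hP : e2 K ^ n = X 0 ^ (n - 1) * X 0 * (X 1 ^ (n - 1) * X 1) := by
    rw [e2, mul_pow, hX, hX]
  have hQ : e2 K ^ (n - 1) = X 0 ^ (n - 1) * X 1 ^ (n - 1) := by rw [e2, mul_pow]
  -- The reason for this choice of generator: it is a perfect square, so its gradient product is
  -- again a multiple of itself and the Laplacian produces only two monomials.
  have hE : quarter K m = C (1 / 4) *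
      (X 0 ^ (n - 1) * X 0 - X 1 ^ (n - 1) * X 1) ^ 2 := by
    rw [quarter, hm2, hP, em, hn, mul_comm 2 n, pow_mul, pow_mul, hX, hX, h2]
    ring
  have hE0 : pderiv 0 (quarter K m) = C (n : K) * C (1 / 4) * 2 *
      (X 0 ^ (n - 1) * (X 0 ^ (n - 1) * X 0 - X 1 ^ (n - 1) * X 1)) := by
    rw [quarter, hm2, map_sub, pderiv_C_mul, pderiv_C_mul, (pderiv_e2_pow n).1, pderiv_em, hX',
      hQ, h2, hn]
    push_cast
    rw [C_mul, map_ofNat]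
    ring
  have hE1 : pderiv 1 (quarter K m) = -(C (n : K) * C (1 / 4) * 2 *
      (X 1 ^ (n - 1) * (X 0 ^ (n - 1) * X 0 - X 1 ^ (n - 1) * X 1))) := by
    rw [quarter, hm2, map_sub, pderiv_C_mul, pderiv_C_mul, (pderiv_e2_pow n).2, pderiv_em, hX',
      hQ, h2, hn]
    push_cast
    rw [C_mul, map_ofNat]
    ring
  have hEE : pderiv 0 (quarter K m) * pderiv 1 (quarter K m) =
      -(C (n : K) ^ 2 * e2 K ^ (n - 1) * quarter K m) := by
    rw [hE0, hE1, hE, hQ]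
    linear_combination (-C (n : K) ^ 2 * (X 0 ^ (n - 1) * X 1 ^ (n - 1)) * C (1 / 4) *
      (X 0 ^ (n - 1) * X 0 - X 1 ^ (n - 1) * X 1) ^ 2) * h4
  have hPP : pderiv 0 (e2 K ^ n) * pderiv 1 (e2 K ^ n) =
      C (n : K) ^ 2 * e2 K ^ (n - 1) * e2 K ^ n := by
    rw [(pderiv_e2_pow n).1, (pderiv_e2_pow n).2, hP, hQ]
    ring
  have hEP : pderiv 0 (quarter K m) * pderiv 1 (e2 K ^ n) +
      pderiv 1 (quarter K m) * pderiv 0 (e2 K ^ n) =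
      C (n : K) ^ 2 * e2 K ^ (n - 1) * (2 * quarter K m) := by
    rw [(pderiv_e2_pow n).1, (pderiv_e2_pow n).2, hE0, hE1, hE, hQ]
    ring
  rw [hm2, lap_pow_mul_pow hEinv hPinv, hEE, hPP, hEP, hlapE, hlapP]
  have g1 := natCast_mul_pow_pred_mul (quarter K m) a
  have g2 := natCast_mul_pow_pred_pred_mul (e2 K ^ n) l
  have g3 := natCast_mul_pow_pred_pred_mul (quarter K m) a
  simp only [map_sub, map_mul, map_natCast, map_add, map_one, map_pow, map_ofNat]
  generalize quarter K m = E at *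
  generalize e2 K ^ n = P at *
  generalize e2 K ^ (n - 1) = Q at *
  linear_combination (-(n : MvPolynomial (Fin 2) K) ^ 2 * Q * P ^ l) * g3 +
    (n ^ 2 * Q * E ^ a) * g2 + (n ^ 2 * Q * l * P ^ (l - 1) * 2) * g1

theorem lap_jacobiInv [CharZero K] (hn : m = 2 * n) (hc : ∀ j, c j = p + q * zeta K m j ^ n)
    {s c₂ : K} (hs : ∀ i : ℕ, s ≠ i) (hsp : s = 2 * p) (hc₂ : c₂ = p + q) (k : ℕ) :
    lap c (jacobiInv m s c₂ k) = 0 := by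
  rw [jacobiInv, lap_sum]
  have h : ∀ j, lap c (C (jacobiCoeff s c₂ k j) *
        (quarter K m ^ j * (e2 K ^ (m / 2)) ^ (k - j))) =
      C (n : K) ^ 2 * e2 K ^ (n - 1) *
        (C (jacobiCoeff s c₂ k j * ((k - j : ℕ) * ((k - j : ℕ) - s + 2 * j))) *
            (quarter K m ^ j * (e2 K ^ (m / 2)) ^ (k - j - 1)) +
          -(C (jacobiCoeff s c₂ k j * (j * (2⁻¹ - c₂ + j - 1))) *
            (quarter K m ^ (j - 1) * (e2 K ^ (m / 2)) ^ (k - j)))) := by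
    intro j
    rw [lap_C_mul _ (mul_mem (pow_mem quarter_mem_invariants _)
      (pow_mem (pow_mem e2_mem_invariants _) _)), lap_quarter_pow_mul_e2_pow hn hc, hsp, hc₂]
    simp only [C_mul]
    ring
  simp only [h]
  rw [← Finset.mul_sum, sum_range_eq_zero_of_telescope, mul_zero]
  · simp
  · simp
  · intro j hj
    rw [Nat.add_sub_cancel, show k - (j + 1) = k - j - 1 by omega,
      jacobiCoeff_recurrence hs hj, add_neg_cancel]

end TwoParameters

/-! ### Two independent formal parameters -/

section Param

theorem zeta_pow_half {m : ℕ} [NeZero m] {K : Type*} [Field K] [Algebra ℂ K] {n : ℕ}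
    (hn : m = 2 * n) (j : ZMod m) : zeta K m j ^ n = if Even j.val then 1 else -1 := by
  have hm := NeZero.ne m
  have h1 : zeta ℂ m 1 ^ n = -1 := by
    have h : (zeta ℂ m 1 ^ n) ^ 2 = 1 := by
      rw [← pow_mul, mul_comm, ← hn, zeta_pow_card]
    exact (sq_eq_one_iff.1 h).resolve_left (zeta_one_pow_ne_one (by omega) (by omega))
  have h2 : zeta K m j = algebraMap ℂ K (zeta ℂ m 1) ^ j.val := by
    rw [algebraMap_zeta, ← zeta_natCast_mul, mul_one, ZMod.natCast_zmod_val]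
  rw [h2, ← pow_mul, mul_comm, pow_mul, ← map_pow, h1, map_neg, map_one]
  split_ifs with h
  · exact h.neg_one_pow
  · exact (Nat.not_even_iff_odd.1 h).neg_one_pow

theorem par1_add_par2_ne_natCast (n : ℕ) : par1 + par2 ≠ n := by
  intro h
  rw [par1, par2, ← map_add, ← map_natCast (algebraMap (MvPolynomial (Fin 2) ℂ) Param)] at h
  have h1 := IsFractionRing.injective (MvPolynomial (Fin 2) ℂ) Param h
  have h2 := congrArg (eval ![(n : ℂ) + 1, 0]) h1
  simp at h2

/-- The canonical invariants for two independent parameters. -/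
def paramInv (m k : ℕ) : MvPolynomial (Fin 2) Param := jacobiInv m (par1 + par2) par2 k

theorem isCanonicalFamily_paramInv {m : ℕ} [NeZero m] (hm : 3 ≤ m) (heven : Even m) :
    IsCanonicalFamily (twoParams m) (paramInv m) := by
  obtain ⟨n, hn⟩ := heven.two_dvd
  have hc : ∀ j, twoParams m j =
      (par1 + par2) / 2 + (par2 - par1) / 2 * zeta Param m j ^ n := by
    intro j
    rw [twoParams, zeta_pow_half hn]
    split_ifs <;> ring
  refine isCanonicalFamily_of_lap_eq_zero hm (MvPolynomial.aeval (0 : Fin 2 → ℂ))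
    (cA := fun j => if Even j.val then X 1 else X 0) ?_ ?_ ?_
    (jacobiInv_mem_invariants _ _) (jacobiInv_isHomogeneous heven _ _)
    (lap_jacobiInv hn hc par1_add_par2_ne_natCast (by ring) (by ring)) ?_
  · intro j
    split_ifs <;> simp
  · intro j
    rw [twoParams]
    split_ifs <;> rfl
  · intro i j
    -- Conjugation preserves the parity of the index: both sides are square roots of one, and their
    -- product is `ζ ^ (2jn) = 1`.
    have h : zeta Param m (2 * j - i) ^ n = zeta Param m i ^ n := by
      have hn0 : (n : ZMod m) * 2 = 0 := by
        have h0 : ((n * 2 : ℕ) : ZMod m) = 0 := by rw [mul_comm, ← hn, CharP.cast_eq_zero]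
        exact_mod_cast h0
      have h1 : zeta Param m (2 * j - i) ^ n * zeta Param m i ^ n = 1 := by
        rw [← mul_pow, ← zeta_add, sub_add_cancel, ← zeta_natCast_mul, ← mul_assoc,
          hn0, zero_mul, zeta_zero]
      have h2 : zeta Param m i ^ n * zeta Param m i ^ n = 1 := by
        rw [← pow_add, ← two_mul, ← hn, zeta_pow_card]
      exact mul_right_cancel₀ (pow_ne_zero n (zeta_ne_zero i)) (h1.trans h2.symm)
    rw [hc, hc, h]
  · intro k
    refine ⟨(k.factorial : ℂ)⁻¹ * (1 / 4) ^ k, mul_ne_zero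
      (inv_ne_zero (Nat.cast_ne_zero.2 k.factorial_ne_zero)) (pow_ne_zero _ (by norm_num)), ?_⟩
    have e : ((k.factorial : ℂ)⁻¹ * (1 / 4) ^ k) • em Param m ^ k =
        ((k.factorial : Param)⁻¹ * (1 / 4) ^ k) • em Param m ^ k := by
      have h4 : algebraMap ℂ Param 4 = 4 := map_ofNat _ 4
      rw [complex_smul_eq, smul_eq_C_mul]
      simp [h4]
    rw [e]
    exact jacobiInv_sub_mem_lowerSpan m (par1 + par2) par2 k

end Param

/-! ### Regularity and values of rational functions -/

section Value

/-- The rational function `x` is a quotient of polynomials with non-vanishing denominator at `γ`,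
and has the value `v` there. -/
def HasValue (γ : Fin 2 → ℂ) (x : Param) (v : ℂ) : Prop :=
  ∃ p q : MvPolynomial (Fin 2) ℂ, eval γ q ≠ 0 ∧
    x = algebraMap _ Param p / algebraMap _ Param q ∧ v = eval γ p / eval γ q

variable {γ : Fin 2 → ℂ} {x y : Param} {v w : ℂ}

/-- By unique factorization the reduced denominator divides the denominator of any other
representation, so one representation without a pole suffices. -/
theorem HasValue.regularAt_and_valueAt (h : HasValue γ x v) :
    RegularAt γ x ∧ valueAt γ x = v := by
  obtain ⟨p, q, hq, rfl, rfl⟩ := h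
  set x : Param := algebraMap _ Param p / algebraMap _ Param q with hx
  have hq0 : q ≠ 0 := by
    rintro rfl
    simp at hq
  have hqK : algebraMap (MvPolynomial (Fin 2) ℂ) Param q ≠ 0 :=
    (map_ne_zero_iff _ (IsFractionRing.injective _ _)).2 hq0
  set N := IsFractionRing.num (MvPolynomial (Fin 2) ℂ) x with hN
  set D : MvPolynomial (Fin 2) ℂ :=
    (IsFractionRing.den (MvPolynomial (Fin 2) ℂ) x : MvPolynomial (Fin 2) ℂ) with hD
  have hD0 : algebraMap (MvPolynomial (Fin 2) ℂ) Param D ≠ 0 :=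
    (map_ne_zero_iff _ (IsFractionRing.injective _ _)).2
      (nonZeroDivisors.ne_zero (IsFractionRing.den (MvPolynomial (Fin 2) ℂ) x).2)
  have h1 : algebraMap _ Param N / algebraMap _ Param D = x := by
    have := IsFractionRing.mk'_num_den (MvPolynomial (Fin 2) ℂ) x
    rwa [IsFractionRing.mk'_eq_div] at this
  have h2 : N * q = p * D := by
    apply IsFractionRing.injective (MvPolynomial (Fin 2) ℂ) Param
    rw [map_mul, map_mul]
    exact (div_eq_div_iff hD0 hqK).1 (h1.trans hx)
  have h3 : D ∣ q := by
    have hrel : IsRelPrime D N := (IsFractionRing.num_den_reduced (MvPolynomial (Fin 2) ℂ) x).symm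
    exact hrel.dvd_of_dvd_mul_left ⟨p, by rw [h2, mul_comm]⟩
  obtain ⟨e, he⟩ := h3
  have hDγ : eval γ D ≠ 0 := by
    intro h
    rw [he, map_mul, h, zero_mul] at hq
    exact hq rfl
  refine ⟨hDγ, ?_⟩
  have h4 := congrArg (eval γ) h2
  rw [map_mul, map_mul] at h4
  exact (div_eq_div_iff hDγ hq).2 h4

theorem hasValue_algebraMap (p : MvPolynomial (Fin 2) ℂ) :
    HasValue γ (algebraMap _ Param p) (eval γ p) :=
  ⟨p, 1, by simp, by simp, by simp⟩

theorem hasValue_natCast (n : ℕ) : HasValue γ (n : Param) n := by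
  simpa using hasValue_algebraMap (γ := γ) (n : MvPolynomial (Fin 2) ℂ)

theorem hasValue_par1 : HasValue γ par1 (γ 0) := by
  have h := hasValue_algebraMap (γ := γ) (X 0)
  rw [eval_X] at h
  exact h

theorem hasValue_par2 : HasValue γ par2 (γ 1) := by
  have h := hasValue_algebraMap (γ := γ) (X 1)
  rw [eval_X] at h
  exact h

theorem algebraMap_ne_zero_of_eval {q : MvPolynomial (Fin 2) ℂ} (hq : eval γ q ≠ 0) :
    algebraMap (MvPolynomial (Fin 2) ℂ) Param q ≠ 0 := by
  refine (map_ne_zero_iff _ (IsFractionRing.injective _ _)).2 ?_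
  rintro rfl
  simp at hq

theorem HasValue.add (hx : HasValue γ x v) (hy : HasValue γ y w) :
    HasValue γ (x + y) (v + w) := by
  obtain ⟨p, q, hq, rfl, rfl⟩ := hx
  obtain ⟨p', q', hq', rfl, rfl⟩ := hy
  refine ⟨p * q' + q * p', q * q', by simp [hq, hq'], ?_, ?_⟩
  · rw [div_add_div _ _ (algebraMap_ne_zero_of_eval hq) (algebraMap_ne_zero_of_eval hq')]
    simp
  · rw [div_add_div _ _ hq hq']
    simp

theorem HasValue.mul (hx : HasValue γ x v) (hy : HasValue γ y w) :
    HasValue γ (x * y) (v * w) := by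
  obtain ⟨p, q, hq, rfl, rfl⟩ := hx
  obtain ⟨p', q', hq', rfl, rfl⟩ := hy
  refine ⟨p * p', q * q', by simp [hq, hq'], ?_, ?_⟩
  · rw [div_mul_div_comm]
    simp
  · rw [div_mul_div_comm]
    simp

theorem HasValue.inv (hx : HasValue γ x v) (hv : v ≠ 0) : HasValue γ x⁻¹ v⁻¹ := by
  obtain ⟨p, q, hq, rfl, rfl⟩ := hx
  exact ⟨q, p, (div_ne_zero_iff.1 hv).1, inv_div _ _, inv_div _ _⟩

theorem HasValue.neg (hx : HasValue γ x v) : HasValue γ (-x) (-v) := by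
  obtain ⟨p, q, hq, rfl, rfl⟩ := hx
  exact ⟨-p, q, hq, by rw [map_neg]; exact (neg_div _ _).symm, by rw [map_neg, neg_div]⟩

theorem HasValue.sub (hx : HasValue γ x v) (hy : HasValue γ y w) :
    HasValue γ (x - y) (v - w) := by
  rw [sub_eq_add_neg, sub_eq_add_neg]
  exact hx.add hy.neg

theorem HasValue.sum {ι : Type*} (s : Finset ι) {x : ι → Param} {v : ι → ℂ}
    (h : ∀ i ∈ s, HasValue γ (x i) (v i)) : HasValue γ (∑ i ∈ s, x i) (∑ i ∈ s, v i) := by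
  classical
  induction s using Finset.induction_on with
  | empty => simpa using hasValue_natCast (γ := γ) 0
  | insert a s ha ih =>
    rw [Finset.sum_insert ha, Finset.sum_insert ha]
    exact (h a (by simp)).add (ih fun i hi => h i (by simp [hi]))

theorem HasValue.ascPochhammer (hx : HasValue γ x v) (n : ℕ) :
    HasValue γ ((ascPochhammer Param n).eval x) ((ascPochhammer ℂ n).eval v) := by
  induction n with
  | zero => simpa using hasValue_natCast (γ := γ) 1
  | succ n ih =>
    rw [ascPochhammer_succ_eval, ascPochhammer_succ_eval]
    exact ih.mul (hx.add (hasValue_natCast n))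

theorem hasValue_jacobiCoeff (h : ∀ n : ℕ, γ 0 + γ 1 ≠ n) (k j : ℕ) :
    HasValue γ (jacobiCoeff (par1 + par2) par2 k j) (jacobiCoeff (γ 0 + γ 1) (γ 1) k j) := by
  rw [jacobiCoeff, jacobiCoeff, div_eq_mul_inv, div_eq_mul_inv]
  have h2 : HasValue γ (2⁻¹ : Param) 2⁻¹ := by
    simpa using (hasValue_natCast (γ := γ) 2).inv (by norm_num)
  refine HasValue.mul (((h2.sub hasValue_par2).add (hasValue_natCast j)).ascPochhammer _) ?_
  refine (((hasValue_natCast _).mul (hasValue_natCast _)).mul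
    ((((hasValue_natCast k).sub (hasValue_par1.add hasValue_par2)).add
      (hasValue_natCast j)).ascPochhammer _)).inv ?_
  refine mul_ne_zero (mul_ne_zero ?_ ?_) (ascPochhammer_natCast_sub_ne_zero h _ _ _)
  · exact Nat.cast_ne_zero.2 (Nat.factorial_ne_zero _)
  · exact Nat.cast_ne_zero.2 (Nat.factorial_ne_zero _)

theorem map_quarter {F G : Type*} [Field F] [Field G] (f : F →+* G) (m : ℕ) :
    map f (quarter F m) = quarter G m := by
  rw [quarter, quarter, map_sub, map_mul, map_mul, map_pow, map_em, map_e2, map_C, map_C]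
  simp [map_ofNat]

theorem hasValue_coeff_paramInv (h : ∀ n : ℕ, γ 0 + γ 1 ≠ n) (m k : ℕ) (d : Fin 2 →₀ ℕ) :
    HasValue γ (coeff d (paramInv m k)) (coeff d (jacobiInv m (γ 0 + γ 1) (γ 1) k)) := by
  rw [paramInv, jacobiInv, jacobiInv, coeff_sum, coeff_sum]
  refine HasValue.sum _ fun j _ => ?_
  rw [coeff_C_mul, coeff_C_mul, ← map_quarter (algebraMap ℂ Param), ← map_e2 (algebraMap ℂ Param),
    ← map_pow, ← map_pow, ← map_pow, ← map_mul, coeff_map]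
  refine (hasValue_jacobiCoeff h k j).mul ?_
  have := hasValue_algebraMap (γ := γ)
    (C (coeff d (quarter ℂ m ^ j * (e2 ℂ ^ (m / 2)) ^ (k - j))))
  rw [eval_C] at this
  exact this

theorem specialize_paramInv (h : ∀ n : ℕ, γ 0 + γ 1 ≠ n) (m k : ℕ) :
    specialize γ (paramInv m k) = jacobiInv m (γ 0 + γ 1) (γ 1) k := by
  ext d
  have hv := fun d => (hasValue_coeff_paramInv h m k d).regularAt_and_valueAt.2
  rw [specialize, coeff_sum]
  simp only [coeff_monomial]
  rw [Finset.sum_ite_eq']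
  split_ifs with hd
  · exact hv d
  · rw [notMem_support_iff] at hd
    rw [← hv d, hd]
    have h0 := (hasValue_natCast (γ := γ) 0).regularAt_and_valueAt.2
    simpa using h0.symm

end Value

/-! ### Beta integrals -/

section Euler

variable {A : Type*} [CommRing A] [Algebra ℂ A]

theorem eulerIntegral_sum_monomial {ι : Type*} (x y : ℂ) (s : Finset ι) (e : ι → ℕ) (a : ι → A) :
    eulerIntegral x y (∑ i ∈ s, Polynomial.monomial (e i) (a i)) =
      ∑ i ∈ s, (Complex.Gamma (x + e i) * Complex.Gamma y / Complex.Gamma (x + e i + y)) • a i := by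
  classical
  have h : ∀ p : Polynomial A, eulerIntegral x y p = p.sum fun j a =>
    (Complex.Gamma (x + j) * Complex.Gamma y / Complex.Gamma (x + j + y)) • a := fun _ => rfl
  induction s using Finset.induction_on with
  | empty => simp [h]
  | insert i s hi ih =>
    rw [Finset.sum_insert hi, Finset.sum_insert hi, ← ih, h, h, Polynomial.sum_add_index,
      Polynomial.sum_monomial_index] <;> simp [smul_add]

theorem eulerIntegral_pow (x y : ℂ) (P Q : A) (k : ℕ) :
    eulerIntegral x y ((Polynomial.X * (Polynomial.C P + Polynomial.X * Polynomial.C Q)) ^ k) =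
      ∑ j ∈ Finset.range (k + 1), (Complex.Gamma (x + (k + j : ℕ)) * Complex.Gamma y /
        Complex.Gamma (x + (k + j : ℕ) + y) * k.choose j) • (Q ^ j * P ^ (k - j)) := by
  have h : (Polynomial.X * (Polynomial.C P + Polynomial.X * Polynomial.C Q)) ^ k =
      ∑ j ∈ Finset.range (k + 1),
        Polynomial.monomial (k + j) ((k.choose j : A) * (Q ^ j * P ^ (k - j))) := by
    rw [mul_pow, add_comm (Polynomial.C P), add_pow, Finset.mul_sum]
    refine Finset.sum_congr rfl fun j _ => ?_
    rw [← Polynomial.C_mul_X_pow_eq_monomial]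
    simp only [map_mul, map_pow, map_natCast]
    ring
  rw [h, eulerIntegral_sum_monomial]
  refine Finset.sum_congr rfl fun j _ => ?_
  rw [mul_smul]
  congr 1
  simp [Algebra.smul_def]

theorem Gamma_add_natCast {z : ℂ} (n : ℕ) (hz : ∀ i < n, z + i ≠ 0) :
    Complex.Gamma (z + n) = (ascPochhammer ℂ n).eval z * Complex.Gamma z := by
  induction n with
  | zero => simp
  | succ n ih =>
    rw [ascPochhammer_succ_eval, Nat.cast_succ, ← add_assoc,
      Complex.Gamma_add_one _ (hz n (by omega)), ih fun i hi => hz i (by omega)]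
    ring

/-- Stated for the reciprocal, which is entire: the convention `1/Γ = 0` at poles makes it valid
without conditions on `z`. -/
theorem inv_Gamma_eq_ascPochhammer_mul (z : ℂ) (n : ℕ) :
    (Complex.Gamma z)⁻¹ = (ascPochhammer ℂ n).eval z * (Complex.Gamma (z + n))⁻¹ := by
  induction n with
  | zero => simp
  | succ n ih =>
    have := Complex.one_div_Gamma_eq_self_mul_one_div_Gamma_add_one (z + n)
    rw [ih, this, ascPochhammer_succ_eval, Nat.cast_succ, add_assoc]
    ring

theorem Gamma_add_one_eq_choose {r : ℂ} (k : ℕ) (hr : ∀ i < k, r ≠ i) :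
    Complex.Gamma (r + 1) = k.factorial * Ring.choose r k * Complex.Gamma (r - k + 1) := by
  induction k with
  | zero => simp
  | succ k ih =>
    have h1 := choose_succ_mul r k
    have h2 := Complex.Gamma_add_one (r - k) (sub_ne_zero.2 (hr k (by omega)))
    rw [ih fun i hi => hr i (by omega), h2, Nat.factorial_succ, Nat.cast_succ,
      show r - (k + 1 : ℂ) + 1 = r - k by ring]
    push_cast
    linear_combination (-(k.factorial : ℂ) * Complex.Gamma (r - k)) * h1

/-- The Beta value attached to `τ ^ (k + j)` has denominator `Γ(1/2 - c₂ + j)`; shifting it to `j =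
k` produces the numerator of `jacobiCoeff`, and shifting `Γ(k + j - s)` up to `Γ(2k - s)` produces
its denominator. Excluding only `r = 0, …, k - 1` serves both the continued and the convergent
integral. -/
theorem Gamma_mul_jacobiCoeff {s c₂ r : ℂ} (hr : r = s - c₂ - 2⁻¹) {k : ℕ}
    (hs : ∀ n : ℕ, s ≠ n) (hrk : ∀ i < k, r ≠ i) {j : ℕ} (hj : j ≤ k) :
    Complex.Gamma (r + 1) * Complex.Gamma (2 * k - s) / Complex.Gamma (k + (2⁻¹ - c₂)) *
        jacobiCoeff s c₂ k j =
      Ring.choose r k * (Complex.Gamma (-s + (k + j : ℕ)) * Complex.Gamma (r - k + 1) /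
        Complex.Gamma (-s + (k + j : ℕ) + (r - k + 1)) * k.choose j) := by
  obtain ⟨i, rfl⟩ := Nat.exists_eq_add_of_le hj
  have h1 := Gamma_add_one_eq_choose _ hrk
  have h2 := Gamma_add_natCast (z := -s + (j + i + j : ℕ)) i fun l _ => by
    intro h
    apply hs (j + i + j + l)
    push_cast at h ⊢
    linear_combination -h
  have h3 := inv_Gamma_eq_ascPochhammer_mul (2⁻¹ - c₂ + j) i
  have h4 := ascPochhammer_natCast_sub_ne_zero hs i (j + i) j
  have e1 : -s + (j + i + j : ℕ) + (i : ℂ) = 2 * (j + i : ℕ) - s := by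
    push_cast
    ring
  have e2 : -s + (j + i + j : ℕ) + (r - (j + i : ℕ) + 1) = 2⁻¹ - c₂ + j := by
    rw [hr]
    push_cast
    ring
  have e3 : ((j + i : ℕ) : ℂ) + (2⁻¹ - c₂) = 2⁻¹ - c₂ + j + i := by
    push_cast
    ring
  have e4 : ((j + i : ℕ) : ℂ) - s + j = -s + (j + i + j : ℕ) := by
    push_cast
    ring
  have e5 : ((j + i).factorial : ℂ) = (j + i).choose j * (j.factorial * i.factorial) := by
    have := Nat.choose_mul_factorial_mul_factorial (Nat.le_add_right j i)
    rw [Nat.add_sub_cancel_left, mul_assoc] at this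
    exact_mod_cast this.symm
  have h5 : (j.factorial : ℂ) ≠ 0 := Nat.cast_ne_zero.2 j.factorial_ne_zero
  have h6 : (i.factorial : ℂ) ≠ 0 := Nat.cast_ne_zero.2 i.factorial_ne_zero
  rw [jacobiCoeff, Nat.add_sub_cancel_left, div_eq_mul_inv _ (Complex.Gamma _),
    div_eq_mul_inv _ (Complex.Gamma _), e2, h3, h1, ← e1, h2, e3, e5]
  rw [e4] at h4 ⊢
  field_simp

theorem smul_sum_jacobiCoeff {s c₂ r : ℂ} (hr : r = s - c₂ - 2⁻¹) {k : ℕ}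
    (hs : ∀ n : ℕ, s ≠ n) (hrk : ∀ i < k, r ≠ i) (P Q : A) :
    (Complex.Gamma (r + 1) * Complex.Gamma (2 * k - s) / Complex.Gamma (k + (2⁻¹ - c₂))) •
        ∑ j ∈ Finset.range (k + 1), jacobiCoeff s c₂ k j • (Q ^ j * P ^ (k - j)) =
      Ring.choose r k • eulerIntegral (-s) (r - k + 1)
        ((Polynomial.X * (Polynomial.C P + Polynomial.X * Polynomial.C Q)) ^ k) := by
  rw [eulerIntegral_pow, Finset.smul_sum, Finset.smul_sum]
  refine Finset.sum_congr rfl fun j hj => ?_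
  rw [Finset.mem_range] at hj
  rw [← mul_smul, ← mul_smul, Gamma_mul_jacobiCoeff hr hs hrk (by omega)]

end Euler

/-! ### Jacobi polynomials -/

section Jacobi

theorem factorial_mul_choose {R : Type*} [CommRing R] [BinomialRing R] (s : R) (k : ℕ) :
    (k.factorial : R) * Ring.choose (2 * k - s - 1) k = (ascPochhammer R k).eval (k - s) := by
  rw [← nsmul_eq_mul, ← Ring.descPochhammer_eq_factorial_smul_choose,
    Polynomial.descPochhammer_smeval_eq_ascPochhammer, Polynomial.ascPochhammer_smeval_eq_eval]
  congr 1
  ring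

variable {F : Type*} [Field F] [CharZero F]

/-- The normalizing symbol factors as `(k - s)_k = (k - s)_j (k - s + j)_{k-j}`, and its first
factor cancels the one in the Jacobi coefficient. -/
theorem inv_mul_jacobi_coeff {s c₂ : F} (hs : ∀ n : ℕ, s ≠ n) {k j : ℕ} (hj : j ≤ k) :
    ((ascPochhammer F k).eval (k - s))⁻¹ * ((k.factorial : F)⁻¹ *
      ((k.choose j : F) * (ascPochhammer F j).eval (k - s) *
        (ascPochhammer F (k - j)).eval (2⁻¹ - c₂ + j))) = jacobiCoeff s c₂ k j := by
  obtain ⟨i, rfl⟩ := Nat.exists_eq_add_of_le hj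
  have h1 := ascPochhammer_eval_add j i (((j + i : ℕ) : F) - s)
  have h2 := ascPochhammer_natCast_sub_ne_zero hs i (j + i) j
  have h3 := ascPochhammer_natCast_sub_ne_zero hs j (j + i) 0
  rw [Nat.cast_zero, add_zero] at h3
  have e5 : ((j + i).factorial : F) = (j + i).choose j * (j.factorial * i.factorial) := by
    have := Nat.choose_mul_factorial_mul_factorial (Nat.le_add_right j i)
    rw [Nat.add_sub_cancel_left, mul_assoc] at this
    exact_mod_cast this.symm
  have h5 : (j.factorial : F) ≠ 0 := Nat.cast_ne_zero.2 j.factorial_ne_zero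
  have h6 : (i.factorial : F) ≠ 0 := Nat.cast_ne_zero.2 i.factorial_ne_zero
  have h7 : ((j + i).choose j : F) ≠ 0 :=
    Nat.cast_ne_zero.2 (Nat.choose_pos (Nat.le_add_right j i)).ne'
  rw [jacobiCoeff, Nat.add_sub_cancel_left, h1, e5]
  field_simp

theorem algebraMap_jacobiInv {L : Type*} [Field L] [Algebra F L]
    [Algebra (MvPolynomial (Fin 2) F) L] [IsScalarTower F (MvPolynomial (Fin 2) F) L]
    [FaithfulSMul (MvPolynomial (Fin 2) F) L] {m : ℕ} (hm : Even m) {s c₂ a b : F}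
    (hs : ∀ n : ℕ, s ≠ n) (ha : a = -c₂ - 2⁻¹) (hab : a + b = -(s + 1)) (k : ℕ) :
    algebraMap (MvPolynomial (Fin 2) F) L (jacobiInv m s c₂ k) =
      algebraMap F L ((ascPochhammer F k).eval (k - s))⁻¹ *
        algebraMap _ L (e2 F) ^ (m * k / 2) *
        Polynomial.aeval (algebraMap (MvPolynomial (Fin 2) F) L (em F m) /
          (2 * algebraMap _ L (e2 F) ^ (m / 2))) (jacobi k a b) := by
  obtain ⟨n, rfl⟩ := hm.two_dvd
  have e1 : 2 * n * k / 2 = n * k := by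
    rw [mul_assoc, Nat.mul_div_cancel_left _ two_pos]
  have e2' : 2 * n / 2 = n := Nat.mul_div_cancel_left _ two_pos
  have : CharZero L := charZero_of_injective_algebraMap (algebraMap F L).injective
  have hC : ∀ x : F, algebraMap (MvPolynomial (Fin 2) F) L (C x) = algebraMap F L x :=
    fun x => (IsScalarTower.algebraMap_apply F (MvPolynomial (Fin 2) F) L x).symm
  have h0 : algebraMap (MvPolynomial (Fin 2) F) L (e2 F) ≠ 0 :=
    (map_ne_zero_iff _ (FaithfulSMul.algebraMap_injective _ _)).2
      (mul_ne_zero (X_ne_zero _) (X_ne_zero _))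
  -- For `y = e_m / (2 e₂ ^ n)` the Jacobi variable `(y - 1) / 2` is `e'_m / e₂ ^ n`.
  have hy : algebraMap F L 2⁻¹ * (algebraMap (MvPolynomial (Fin 2) F) L (em F (2 * n)) /
      (2 * algebraMap _ L (e2 F) ^ n) - 1) =
      algebraMap (MvPolynomial (Fin 2) F) L (quarter F (2 * n)) / algebraMap _ L (e2 F) ^ n := by
    rw [quarter, e2', map_sub, map_mul, map_mul, hC, hC, map_pow]
    simp only [one_div, map_inv₀, map_ofNat]
    field_simp
    ring
  rw [jacobiInv, jacobi, e1, e2', map_mul (Polynomial.aeval _), map_sum,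
    map_sum, Finset.mul_sum, Finset.mul_sum, Polynomial.aeval_C]
  refine Finset.sum_congr rfl fun j hj => ?_
  rw [Finset.mem_range] at hj
  rw [← inv_mul_jacobi_coeff hs (Nat.lt_succ_iff.1 hj), map_mul (algebraMap _ L), hC,
    map_mul (Polynomial.aeval _), map_pow (Polynomial.aeval _), map_mul (Polynomial.aeval _),
    Polynomial.aeval_C, Polynomial.aeval_C, map_sub, Polynomial.aeval_X, map_one, hy,
    map_mul (algebraMap _ L) (quarter F (2 * n) ^ j), map_pow (algebraMap _ L) (quarter F (2 * n)),
    map_pow (algebraMap _ L) (e2 F ^ n), map_pow (algebraMap _ L) (e2 F)]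
  have h1 : (k : F) + a + b + 1 = k - s := by linear_combination hab
  have h2 : a + j + 1 = 2⁻¹ - c₂ + j := by
    rw [ha]
    ring
  rw [h1, h2]
  obtain ⟨i, rfl⟩ := Nat.exists_eq_add_of_le (Nat.lt_succ_iff.1 hj)
  rw [Nat.add_sub_cancel_left, mul_add n, pow_add, pow_mul, pow_mul, div_pow]
  simp only [map_mul]
  generalize algebraMap (MvPolynomial (Fin 2) F) L (e2 F) = P at *
  field_simp

end Jacobi

theorem jacobiInv_eq_sum_smul (m : ℕ) (s c₂ : ℂ) (k : ℕ) : jacobiInv m s c₂ k =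
    ∑ j ∈ Finset.range (k + 1),
      jacobiCoeff s c₂ k j • (em' m ^ j * (e2 ℂ ^ (m / 2)) ^ (k - j)) := by
  simp only [smul_eq_C_mul]
  rfl

end Dihedral

end

theorem mainTheorem4 (m : ℕ) [NeZero m] (hm : 3 ≤ m) :
    -- equal parameters, over the field of rational functions of `c`
    (∃ b : ℕ → MvPolynomial (Fin 2) (RatFunc ℂ),
      Dihedral.IsCanonicalFamily (fun _ : ZMod m => (RatFunc.X : RatFunc ℂ)) b ∧
      PowerSeries.mk (fun k => Ring.choose (RatFunc.X : RatFunc ℂ) k • b k) =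
        (PowerSeries.binomialSeries (MvPolynomial (Fin 2) (RatFunc ℂ))
          (RatFunc.X : RatFunc ℂ)).subst
          (PowerSeries.C (Dihedral.em (RatFunc ℂ) m) * PowerSeries.X +
            PowerSeries.C (Dihedral.e2 (RatFunc ℂ) ^ m) * PowerSeries.X ^ 2 :
            PowerSeries (MvPolynomial (Fin 2) (RatFunc ℂ)))) ∧
    -- two independent parameters, over the field of rational functions of `c₁, c₂`
    (Even m → ∃ b : ℕ → MvPolynomial (Fin 2) Dihedral.Param,
      Dihedral.IsCanonicalFamily (Dihedral.twoParams m) b ∧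
      -- no poles outside of `C = 0, 1, 2, …`
      (∀ c₁ c₂ : ℂ, (∀ n : ℕ, c₁ + c₂ ≠ n) →
        ∀ k d, Dihedral.RegularAt ![c₁, c₂] ((b k).coeff d)) ∧
      -- the generating function, with the analytically continued integral
      (∀ c₁ c₂ C δ : ℂ, C = c₁ + c₂ → δ = c₂ - c₁ →
        (∀ n : ℕ, C ≠ n) → (∀ n : ℤ, (C - δ - 1) / 2 ≠ n) →
        PowerSeries.mk (fun k : ℕ =>
            (Complex.Gamma ((C - δ + 1) / 2) * Complex.Gamma (2 * k - C) /
              Complex.Gamma (k - (C + δ - 1) / 2)) • Dihedral.specialize ![c₁, c₂] (b k)) =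
          Dihedral.eulerSeries ((C - δ - 1) / 2) (-C)
            (Dihedral.e2 ℂ ^ (m / 2)) (Dihedral.em' m)) ∧
      -- the coefficients of `t ^ k` in the range where the integral converges
      (∀ c₁ c₂ C δ : ℂ, C = c₁ + c₂ → δ = c₂ - c₁ →
        ∀ k : ℕ, C.re < 0 → (k : ℝ) - 1 < ((C - δ - 1) / 2).re → ∀ v : Fin 2 → ℂ,
        Complex.Gamma ((C - δ + 1) / 2) * Complex.Gamma (2 * k - C) /
            Complex.Gamma (k - (C + δ - 1) / 2) *
            MvPolynomial.eval v (Dihedral.specialize ![c₁, c₂] (b k)) =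
          ∫ τ in (0 : ℝ)..1, Ring.choose ((C - δ - 1) / 2) k *
            (1 - τ : ℂ) ^ ((C - δ - 1) / 2 - k) *
            (τ * (MvPolynomial.eval v (Dihedral.e2 ℂ ^ (m / 2)) +
              τ * MvPolynomial.eval v (Dihedral.em' m))) ^ k *
            (τ : ℂ) ^ (-C - 1)) ∧
      -- Jacobi polynomials
      (∀ C δ : Dihedral.Param, C = Dihedral.par1 + Dihedral.par2 →
        δ = Dihedral.par2 - Dihedral.par1 → ∀ k : ℕ,
        algebraMap (MvPolynomial (Fin 2) Dihedral.Param)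
            (FractionRing (MvPolynomial (Fin 2) Dihedral.Param)) (b k) =
          algebraMap Dihedral.Param (FractionRing (MvPolynomial (Fin 2) Dihedral.Param))
            ((k.factorial : Dihedral.Param) * Ring.choose (2 * k - C - 1) k)⁻¹ *
          algebraMap _ _ (Dihedral.e2 Dihedral.Param) ^ (m * k / 2) *
          Polynomial.aeval
            (algebraMap (MvPolynomial (Fin 2) Dihedral.Param)
                (FractionRing (MvPolynomial (Fin 2) Dihedral.Param)) (Dihedral.em _ m) /
              (2 * algebraMap _ _ (Dihedral.e2 Dihedral.Param) ^ (m / 2)))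
            (Dihedral.jacobi k (-(C + δ + 1) / 2) (-(C - δ + 1) / 2)))) := by
  refine ⟨Dihedral.exists_isCanonicalFamily_equal_parameters m hm, fun heven =>
    ⟨Dihedral.paramInv m, Dihedral.isCanonicalFamily_paramInv hm heven, ?_, ?_, ?_, ?_⟩⟩
  · intro c₁ c₂ h k d
    exact (Dihedral.hasValue_coeff_paramInv (γ := ![c₁, c₂]) h m k d).regularAt_and_valueAt.1
  · intro c₁ c₂ s δ hs hδ hsn hr
    have hγ : ∀ n : ℕ, (![c₁, c₂] : Fin 2 → ℂ) 0 + ![c₁, c₂] 1 ≠ n := fun n => by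
      simpa [← hs] using hsn n
    ext1 k
    rw [PowerSeries.coeff_mk, Dihedral.eulerSeries, PowerSeries.coeff_mk,
      Dihedral.specialize_paramInv hγ, Dihedral.jacobiInv_eq_sum_smul]
    simp only [Matrix.cons_val_zero, Matrix.cons_val_one, ← hs]
    have hr' : (s - δ - 1) / 2 = s - c₂ - 2⁻¹ := by
      rw [hs, hδ]
      ring
    rw [← Dihedral.smul_sum_jacobiCoeff hr' hsn fun i _ => by exact_mod_cast hr i]
    congr 5
    · ring
    · rw [hs, hδ]
      ring
  · intro c₁ c₂ s δ hs hδ k hre hk v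
    have hsn : ∀ n : ℕ, s ≠ n := by
      rintro n rfl
      rw [Complex.natCast_re] at hre
      exact absurd hre (not_lt.2 n.cast_nonneg)
    have hγ : ∀ n : ℕ, (![c₁, c₂] : Fin 2 → ℂ) 0 + ![c₁, c₂] 1 ≠ n := fun n => by
      simpa [← hs] using hsn n
    -- Convergence at `τ = 1` already forces the real part above `k - 1`, which excludes the
    -- forbidden integers.
    have hrk : ∀ i < k, (s - δ - 1) / 2 ≠ i := by
      intro i hi h
      rw [h, Complex.natCast_re] at hk
      have : (i : ℝ) + 1 ≤ k := by exact_mod_cast hi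
      linarith
    have hr' : (s - δ - 1) / 2 = s - c₂ - 2⁻¹ := by
      rw [hs, hδ]
      ring
    have key := Dihedral.smul_sum_jacobiCoeff hr' hsn hrk
      (MvPolynomial.eval v (Dihedral.e2 ℂ ^ (m / 2))) (MvPolynomial.eval v (Dihedral.em' m))
    rw [Dihedral.eulerIntegral_eq_integral _ _ (by simpa using hre)
      (by simp only [Complex.add_re, Complex.sub_re, Complex.natCast_re, Complex.one_re]; linarith),
      smul_eq_mul, smul_eq_mul, ← intervalIntegral.integral_const_mul] at key
    rw [Dihedral.specialize_paramInv hγ, Dihedral.jacobiInv_eq_sum_smul]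
    simp only [Matrix.cons_val_zero, Matrix.cons_val_one, ← hs, map_sum, MvPolynomial.smul_eval,
      map_mul, map_pow]
    simp only [smul_eq_mul, map_pow] at key
    have e1 : (s - δ + 1) / 2 = (s - δ - 1) / 2 + 1 := by ring
    have e2 : (k : ℂ) - (s + δ - 1) / 2 = k + (2⁻¹ - c₂) := by
      rw [hs, hδ]
      ring
    rw [e1, e2, key]
    congr 1
    ext τ
    rw [add_sub_cancel_right]
    simp only [Polynomial.eval_pow, Polynomial.eval_mul, Polynomial.eval_add, Polynomial.eval_X,
      Polynomial.eval_C]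
    ring
  · intro s δ hs hδ k
    rw [hs, Dihedral.factorial_mul_choose]
    refine Dihedral.algebraMap_jacobiInv
      (L := FractionRing (MvPolynomial (Fin 2) Dihedral.Param)) heven
      Dihedral.par1_add_par2_ne_natCast ?_ ?_ k
    · rw [hδ]
      ring
    · ring
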